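/- Let $R$ be an associative ring with identity. A left $R$-module $N$ is super finitely presented if it has a resolution $\cdots\to F_1\to F_0\to N\to 0$ by finitely generated projective modules. A right $R$-module $M$ is weak flat if $\operatorname{Tor}_1^R(M,N)=0$ for every super finitely presented left $R$-module $N$; its weak flat dimension $\operatorname{wfd}_R(M)$ is the least $m\ge 0$ such that $\operatorname{Tor}_{m+1}^R(M,N)=0$ for every super finitely presented $N$ (and $\infty$ if there is none). A left $\mathcal{WF}$-resolution of $M$ is a complex $\cdots\to W_1\to W_0\to M\to 0$ with every $W_i$ weak flat that stays exact under $\operatorname{Hom}_R(V,-)$ for every weak flat right $R$-module $V$. For a right $R$-module $L$, $\operatorname{Ext}^{\mathcal{WF}}_m(L,M)$ is the $m$-th homology group of the deleted complex $\cdots\to\operatorname{Hom}_R(L,W_1)\to\operatorname{Hom}_R(L,W_0)\to 0$. A right $R$-module $L$ is pure projective if $\operatorname{Hom}_R(L,-)$ is exact on all short exact sequences of right $R$-modules that stay exact under $-\otimes_R Q$ for every left $R$-module $Q$. Let $n\ge 2$ and let $M$ be a right $R$-module. Then $M$ has a left $\mathcal{WF}$-resolution, and whichever left $\mathcal{WF}$-resolution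 of $M$ is used to compute $\operatorname{Ext}^{\mathcal{WF}}$, the following are equivalent: (1) $\operatorname{wfd}_R(M)\le n$; (2) $\operatorname{Ext}^{\mathcal{WF}}_{n+k}(L,M)=0$ for every right $R$-module $L$ and every $k\ge -1$; (3) $\operatorname{Ext}^{\mathcal{WF}}_{n-1}(L,M)=0$ for every right $R$-module $L$; (4) $\operatorname{Ext}^{\mathcal{WF}}_{n+k}(L,M)=0$ for every pure projective right $R$-module $L$ and every $k\ge -1$; (5) $\operatorname{Ext}^{\mathcal{WF}}_{n-1}(L,M)=0$ for every pure projective right $R$-module $L$; (6) $\operatorname{Ext}^{\mathcal{WF}}_{n+k}(L,M)=0$ for every finitely presented right $R$-module $L$ and every $k\ge -1$; (7) $\operatorname{Ext}^{\mathcal{WF}}_{n-1}(L,M)=0$ for every finitely presented right $R$-module $L$. -/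

import Mathlib

open CategoryTheory

universe u

noncomputable section

/-! Throughout, `R` is an associative ring with identity. Left `R`-modules carry an instance
`Module R N`, right `R`-modules an instance `Module Rᵐᵒᵖ M`, so that `m r` is
`MulOpposite.op r • m`. -/

/-- The subgroup of `M ⊗[ℤ] N` generated by the elements `(m r) ⊗ n - m ⊗ (r n)`. -/
def balancedRelations (R M N : Type u) [Ring R] [AddCommGroup M] [Module Rᵐᵒᵖ M]
    [AddCommGroup N] [Module R N] : AddSubgroup (TensorProduct ℤ M N) :=
  AddSubgroup.closure {x | ∃ (m : M) (r : R) (n : N),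
    x = TensorProduct.tmul ℤ (MulOpposite.op r • m) n - TensorProduct.tmul ℤ m (r • n)}

/-- The tensor product `M ⊗_R N` of a right `R`-module and a left `R`-module, an abelian group. -/
abbrev BalancedTensor (R M N : Type u) [Ring R] [AddCommGroup M] [Module Rᵐᵒᵖ M]
    [AddCommGroup N] [Module R N] : Type u :=
  TensorProduct ℤ M N ⧸ balancedRelations R M N

/-- The pure tensor `m ⊗ n` in `M ⊗_R N`. -/
def BalancedTensor.tmul (R : Type u) {M N : Type u} [Ring R] [AddCommGroup M] [Module Rᵐᵒᵖ M]
    [AddCommGroup N] [Module R N] (m : M) (n : N) : BalancedTensor R M N :=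
  QuotientAddGroup.mk (TensorProduct.tmul ℤ m n)

/-- Homomorphisms out of `M ⊗_R N` agree if they agree on pure tensors. -/
theorem BalancedTensor.hom_ext {R M N A : Type u} [Ring R] [AddCommGroup M] [Module Rᵐᵒᵖ M]
    [AddCommGroup N] [Module R N] [AddCommGroup A] {f g : BalancedTensor R M N →+ A}
    (h : ∀ (m : M) (n : N), f (BalancedTensor.tmul R m n) = g (BalancedTensor.tmul R m n)) :
    f = g := by
  refine QuotientAddGroup.addMonoidHom_ext _ (AddMonoidHom.ext fun x => ?_)
  induction x using TensorProduct.induction_on with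
  | zero => rw [map_zero, map_zero]
  | tmul m n => exact h m n
  | add x y hx hy => rw [map_add, map_add, hx, hy]

/-- The homomorphism `f ⊗_R g`. -/
def BalancedTensor.map {R M M' N N' : Type u} [Ring R]
    [AddCommGroup M] [Module Rᵐᵒᵖ M] [AddCommGroup M'] [Module Rᵐᵒᵖ M']
    [AddCommGroup N] [Module R N] [AddCommGroup N'] [Module R N']
    (f : M →ₗ[Rᵐᵒᵖ] M') (g : N →ₗ[R] N') :
    BalancedTensor R M N →+ BalancedTensor R M' N' :=
  QuotientAddGroup.map _ _
    (TensorProduct.map f.toAddMonoidHom.toIntLinearMap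
      g.toAddMonoidHom.toIntLinearMap).toAddMonoidHom
    (by
      refine (AddSubgroup.closure_le _).2 ?_
      rintro _ ⟨m, r, n, rfl⟩
      refine AddSubgroup.subset_closure ⟨f m, r, g n, ?_⟩
      rw [map_sub, ← map_smul f, ← map_smul g]
      rfl)

theorem BalancedTensor.map_tmul {R M M' N N' : Type u} [Ring R]
    [AddCommGroup M] [Module Rᵐᵒᵖ M] [AddCommGroup M'] [Module Rᵐᵒᵖ M']
    [AddCommGroup N] [Module R N] [AddCommGroup N'] [Module R N']
    (f : M →ₗ[Rᵐᵒᵖ] M') (g : N →ₗ[R] N') (m : M) (n : N) :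
    BalancedTensor.map f g (BalancedTensor.tmul R m n) = BalancedTensor.tmul R (f m) (g n) := rfl

/-- The functor `M ⊗_R -` from left `R`-modules to abelian groups. -/
def balancedTensorFunctor (R M : Type u) [Ring R] [AddCommGroup M] [Module Rᵐᵒᵖ M] :
    ModuleCat.{u} R ⥤ AddCommGrpCat.{u} where
  obj N := AddCommGrpCat.of (BalancedTensor R M N)
  map g := AddCommGrpCat.ofHom (BalancedTensor.map LinearMap.id g.hom)
  map_id _ := AddCommGrpCat.hom_ext (BalancedTensor.hom_ext fun _ _ => rfl)
  map_comp _ _ := AddCommGrpCat.hom_ext (BalancedTensor.hom_ext fun _ _ => rfl)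

instance (R M : Type u) [Ring R] [AddCommGroup M] [Module Rᵐᵒᵖ M] :
    (balancedTensorFunctor R M).Additive where
  map_add {_ _ f g} := AddCommGrpCat.hom_ext (BalancedTensor.hom_ext fun m n =>
    congrArg QuotientAddGroup.mk (TensorProduct.tmul_add m (f.hom n) (g.hom n)))

/-- `Tor_n^R(M, N)`: the `n`-th left derived functor of `M ⊗_R -`, evaluated at `N`. -/
def rightLeftTor (R M : Type u) [Ring R] [AddCommGroup M] [Module Rᵐᵒᵖ M] (n : ℕ)
    (N : ModuleCat.{u} R) : AddCommGrpCat.{u} :=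
  ((balancedTensorFunctor R M).leftDerived n).obj N

/-- A left module is super finitely presented if it has a resolution
`⋯ → F₁ → F₀ → N → 0` by finitely generated projective modules. -/
def IsSuperFinitelyPresented {R : Type u} [Ring R] (N : ModuleCat.{u} R) : Prop :=
  ∃ F : ProjectiveResolution N, ∀ i, Module.Finite R (F.complex.X i)

/-- A right module `M` is weak flat if `Tor_1^R(M, N) = 0` for every super finitely presented left
module `N`. -/
def IsWeakFlat (R M : Type u) [Ring R] [AddCommGroup M] [Module Rᵐᵒᵖ M] : Prop :=
  ∀ N : ModuleCat.{u} R, IsSuperFinitelyPresented N → Subsingleton (rightLeftTor R M 1 N)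

/-- The weak flat dimension of a right module `M`: the least `n : ℕ` with `Tor_{n+1}^R(M, N) = 0`
for every super finitely presented left module `N`, and `⊤` if there is no such `n`. -/
def weakFlatDim (R M : Type u) [Ring R] [AddCommGroup M] [Module Rᵐᵒᵖ M] : ℕ∞ :=
  sInf {d : ℕ∞ | ∃ n : ℕ, d = n ∧ ∀ N : ModuleCat.{u} R, IsSuperFinitelyPresented N →
    Subsingleton (rightLeftTor R M (n + 1) N)}

/-- A left `𝒲ℱ`-resolution of a right module `M`: a complex `⋯ → W₁ → W₀ → M → 0` with every `Wᵢ`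
weak flat which stays exact under `Hom_R(V, -)` for every weak flat right module `V`. -/
structure LeftWFResolution (R M : Type u) [Ring R] [AddCommGroup M] [Module Rᵐᵒᵖ M] where
  /-- The modules `Wᵢ`. -/
  W : ℕ → Type u
  [addCommGroup : ∀ i, AddCommGroup (W i)]
  [module : ∀ i, Module Rᵐᵒᵖ (W i)]
  /-- The differentials `Wᵢ₊₁ → Wᵢ`. -/
  d : ∀ i, W (i + 1) →ₗ[Rᵐᵒᵖ] W i
  /-- The augmentation `W₀ → M`. -/
  aug : W 0 →ₗ[Rᵐᵒᵖ] M
  d_comp_d : ∀ i, d i ∘ₗ d (i + 1) = 0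
  aug_comp_d : aug ∘ₗ d 0 = 0
  isWeakFlat : ∀ i, IsWeakFlat R (W i)
  hom_exact_aug : ∀ (V : Type u) [AddCommGroup V] [Module Rᵐᵒᵖ V], IsWeakFlat R V →
    ∀ f : V →ₗ[Rᵐᵒᵖ] M, ∃ g : V →ₗ[Rᵐᵒᵖ] W 0, aug ∘ₗ g = f
  hom_exact_zero : ∀ (V : Type u) [AddCommGroup V] [Module Rᵐᵒᵖ V], IsWeakFlat R V →
    ∀ f : V →ₗ[Rᵐᵒᵖ] W 0, aug ∘ₗ f = 0 → ∃ g : V →ₗ[Rᵐᵒᵖ] W 1, d 0 ∘ₗ g = f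
  hom_exact_succ : ∀ (V : Type u) [AddCommGroup V] [Module Rᵐᵒᵖ V], IsWeakFlat R V →
    ∀ (i : ℕ) (f : V →ₗ[Rᵐᵒᵖ] W (i + 1)), d i ∘ₗ f = 0 →
      ∃ g : V →ₗ[Rᵐᵒᵖ] W (i + 2), d (i + 1) ∘ₗ g = f

namespace LeftWFResolution

attribute [instance] LeftWFResolution.addCommGroup LeftWFResolution.module

variable {R M : Type u} [Ring R] [AddCommGroup M] [Module Rᵐᵒᵖ M]
  (P : LeftWFResolution R M) (L : Type u) [AddCommGroup L] [Module Rᵐᵒᵖ L]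

/-- The differential `Hom_R(L, Wᵢ₊₁) → Hom_R(L, Wᵢ)` of the complex `Hom_R(L, W)`. -/
def homD (i : ℕ) : (L →ₗ[Rᵐᵒᵖ] P.W (i + 1)) →+ (L →ₗ[Rᵐᵒᵖ] P.W i) where
  toFun f := P.d i ∘ₗ f
  map_zero' := LinearMap.comp_zero _
  map_add' f g := LinearMap.comp_add f g _

/-- The `n`-cycles of the deleted complex `⋯ → Hom_R(L, W₁) → Hom_R(L, W₀) → 0`. -/
def cycles : (n : ℕ) → AddSubgroup (L →ₗ[Rᵐᵒᵖ] P.W n)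
  | 0 => ⊤
  | n + 1 => (P.homD L n).ker

/-- The `n`-boundaries of the deleted complex `⋯ → Hom_R(L, W₁) → Hom_R(L, W₀) → 0`. -/
def boundaries (n : ℕ) : AddSubgroup (L →ₗ[Rᵐᵒᵖ] P.W n) := (P.homD L n).range

/-- `Ext^{𝒲ℱ}_n(L, M)`, computed with the left `𝒲ℱ`-resolution `P` of `M`: the `n`-th homology group
of the deleted complex `⋯ → Hom_R(L, W₁) → Hom_R(L, W₀) → 0`. -/
abbrev ExtWF (n : ℕ) : Type u :=
  P.cycles L n ⧸ (P.boundaries L n).addSubgroupOf (P.cycles L n)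

end LeftWFResolution

/-- The sequence `0 → A → B → C → 0` of right modules, with maps `i` and `p`, is pure exact: it is
exact and stays exact under `- ⊗_R Q` for every left module `Q`. -/
def IsPureShortExact {R A B C : Type u} [Ring R] [AddCommGroup A] [Module Rᵐᵒᵖ A]
    [AddCommGroup B] [Module Rᵐᵒᵖ B] [AddCommGroup C] [Module Rᵐᵒᵖ C]
    (i : A →ₗ[Rᵐᵒᵖ] B) (p : B →ₗ[Rᵐᵒᵖ] C) : Prop :=
  (Function.Injective i ∧ Function.Exact i p ∧ Function.Surjective p) ∧
  ∀ (Q : Type u) [AddCommGroup Q] [Module R Q],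
    Function.Injective (BalancedTensor.map i (LinearMap.id : Q →ₗ[R] Q)) ∧
    Function.Exact (BalancedTensor.map i (LinearMap.id : Q →ₗ[R] Q))
      (BalancedTensor.map p (LinearMap.id : Q →ₗ[R] Q)) ∧
    Function.Surjective (BalancedTensor.map p (LinearMap.id : Q →ₗ[R] Q))

/-- A right module `L` is pure projective if `Hom_R(L, -)` is exact on all pure exact sequences
`0 → A → B → C → 0`. -/
def IsPureProjective (R L : Type u) [Ring R] [AddCommGroup L] [Module Rᵐᵒᵖ L] : Prop :=
  ∀ (A B C : Type u) [AddCommGroup A] [Module Rᵐᵒᵖ A] [AddCommGroup B] [Module Rᵐᵒᵖ B]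
    [AddCommGroup C] [Module Rᵐᵒᵖ C] (i : A →ₗ[Rᵐᵒᵖ] B) (p : B →ₗ[Rᵐᵒᵖ] C),
    IsPureShortExact i p →
      Function.Injective (fun f : L →ₗ[Rᵐᵒᵖ] A => i ∘ₗ f) ∧
      Function.Exact (fun f : L →ₗ[Rᵐᵒᵖ] A => i ∘ₗ f) (fun f : L →ₗ[Rᵐᵒᵖ] B => p ∘ₗ f) ∧
      Function.Surjective (fun f : L →ₗ[Rᵐᵒᵖ] B => p ∘ₗ f)

end

/-! Everything is reduced to one condition, `TorVanishes R M i`: tensoring `M` with any exact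
sequence of finitely generated projective left modules is exact in degree `i + 1`. Such sequences
are exactly the resolutions of super finitely presented modules, so the case `i = 0` is weak
flatness and the general case is `wfd M ≤ i` (`torVanishes_iff`, `weakFlatDim_le_iff`).

Equivalences. Since `R` itself is weak flat, every left weak flat resolution is exact, and dimension
shifting gives `wfd M ≤ t + 2` if and only if `ker (d t)` is weak flat (`torVanishes_ker_d_iff`). If
it is, Hom-exactness lifts the inclusion of `ker (d t)` through `d (t + 1)`; composing with that
lift kills the homology in degree `t + 1` for every `L`. Conversely, if the homology vanishes for
finitely presented `L`, then `W (t + 2) → ker (d t)` is a pure epimorphism, and a pure quotient of a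
weak flat module is weak flat. Pure projective modules lie in between, because finitely presented
modules are pure projective. Purity is handled throughout as solvability of finite linear systems
(`LiftsSolutions`, `IsPureSubmodule`).

Existence. It suffices to find weak flat precovers and iterate kernels. Weak flat modules are closed
under pure submodules and pure quotients, and each element lies in a pure submodule that is a
quotient of one fixed free module. Factor `0 → M` by the small object argument for the inclusions
into this free module with weak flat quotient. The middle term is weak flat because weak flatness is
a lifting property against character modules (`exists_lift_dualMap`). The second map is a precover
because lifts extend along a chain of pure submodules (`exists_extension_lift`). -/

noncomputable section

/-! ### Universal property and functoriality of the balanced tensor product. -/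

namespace BalancedTensor

variable {R M M' N N' : Type u} [Ring R]
    [AddCommGroup M] [Module Rᵐᵒᵖ M] [AddCommGroup M'] [Module Rᵐᵒᵖ M']
    [AddCommGroup N] [Module R N] [AddCommGroup N'] [Module R N']

theorem tmul_add (m : M) (n n' : N) :
    tmul R m (n + n') = tmul R m n + tmul R m n' :=
  congrArg QuotientAddGroup.mk (TensorProduct.tmul_add m n n')

theorem add_tmul (m m' : M) (n : N) :
    tmul R (m + m') n = tmul R m n + tmul R m' n :=
  congrArg QuotientAddGroup.mk (TensorProduct.add_tmul m m' n)

theorem smul_tmul (m : M) (r : R) (n : N) :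
    tmul R (MulOpposite.op r • m) n = tmul R m (r • n) :=
  (QuotientAddGroup.eq_iff_sub_mem).2 (AddSubgroup.subset_closure ⟨m, r, n, rfl⟩)

/-- The pure tensor as a biadditive map. -/
def mk (R M N : Type u) [Ring R] [AddCommGroup M] [Module Rᵐᵒᵖ M]
    [AddCommGroup N] [Module R N] : M →+ N →+ BalancedTensor R M N :=
  AddMonoidHom.mk' (fun m => AddMonoidHom.mk' (fun n => tmul R m n) (tmul_add m))
    (fun m m' => AddMonoidHom.ext fun n => add_tmul m m' n)

@[simp] theorem mk_apply (m : M) (n : N) : mk R M N m n = tmul R m n := rfl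

/-- The homomorphism out of `M ⊗_R N` induced by a balanced biadditive map. -/
def lift {A : Type*} [AddCommGroup A] (f : M →+ N →+ A)
    (hf : ∀ (m : M) (r : R) (n : N), f (MulOpposite.op r • m) n = f m (r • n)) :
    BalancedTensor R M N →+ A :=
  QuotientAddGroup.lift _ (TensorProduct.liftAddHom f fun z m n => by
      rw [map_zsmul, map_zsmul, AddMonoidHom.zsmul_apply])
    ((AddSubgroup.closure_le _).2 (by
      rintro _ ⟨m, r, n, rfl⟩
      change TensorProduct.liftAddHom f _ _ = 0
      rw [map_sub, TensorProduct.liftAddHom_tmul, TensorProduct.liftAddHom_tmul, hf, sub_self]))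

theorem map_comp_apply {M'' N'' : Type u} [AddCommGroup M''] [Module Rᵐᵒᵖ M'']
    [AddCommGroup N''] [Module R N''] (f : M →ₗ[Rᵐᵒᵖ] M') (g : N →ₗ[R] N')
    (f' : M' →ₗ[Rᵐᵒᵖ] M'') (g' : N' →ₗ[R] N'') (t : BalancedTensor R M N) :
    map f' g' (map f g t) = map (f' ∘ₗ f) (g' ∘ₗ g) t := by
  have : (map f' g').comp (map f g) = map (f' ∘ₗ f) (g' ∘ₗ g) := hom_ext fun _ _ => rfl
  exact DFunLike.congr_fun this t

theorem map_comm (f : M →ₗ[Rᵐᵒᵖ] M') (g : N →ₗ[R] N') (t : BalancedTensor R M N) :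
    map f LinearMap.id (map LinearMap.id g t) = map LinearMap.id g (map f LinearMap.id t) := by
  rw [map_comp_apply, map_comp_apply]; rfl

theorem map_zero_left (g : N →ₗ[R] N') (t : BalancedTensor R M N) :
    map (0 : M →ₗ[Rᵐᵒᵖ] M') g t = 0 := by
  have : map (0 : M →ₗ[Rᵐᵒᵖ] M') g = 0 := hom_ext fun m n =>
    (DFunLike.congr_fun (map_zero (mk R M' N')) (g n) :)
  exact DFunLike.congr_fun this t

theorem map_zero_right (f : M →ₗ[Rᵐᵒᵖ] M') (t : BalancedTensor R M N) :
    map f (0 : N →ₗ[R] N') t = 0 := by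
  have : map f (0 : N →ₗ[R] N') = 0 := hom_ext fun m n => map_zero (mk R M' N' (f m))
  exact DFunLike.congr_fun this t

end BalancedTensor

/-! ### Coordinates on tensor products with finitely generated projectives. -/

/-- The action of a matrix over `R` on row vectors with entries in a right module. -/
def rowMul {R : Type u} [Ring R] (M : Type u) [AddCommGroup M] [Module Rᵐᵒᵖ M]
    {m n : ℕ} (D : Matrix (Fin m) (Fin n) R) :
    (Fin m → M) →+ (Fin n → M) where
  toFun x j := ∑ i, MulOpposite.op (D i j) • x i
  map_zero' := by ext; simp
  map_add' x y := by ext; simp [Finset.sum_add_distrib]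

section rowMul

variable {R M M' : Type u} [Ring R] [AddCommGroup M] [Module Rᵐᵒᵖ M] [AddCommGroup M']
  [Module Rᵐᵒᵖ M']

theorem rowMul_apply {m n : ℕ} (D : Matrix (Fin m) (Fin n) R) (x : Fin m → M) (j : Fin n) :
    rowMul M D x j = ∑ i, MulOpposite.op (D i j) • x i := rfl

theorem rowMul_comp (f : M →ₗ[Rᵐᵒᵖ] M') {m n : ℕ} (D : Matrix (Fin m) (Fin n) R)
    (x : Fin m → M) : rowMul M' D (f ∘ x) = f ∘ rowMul M D x := by
  ext j; simp [rowMul_apply]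

end rowMul

/-- A presentation of a left module as a retract of `R ^ rank`. -/
structure FreeRetract (R P : Type u) [Ring R] [AddCommGroup P] [Module R P] where
  rank : ℕ
  incl : P →ₗ[R] (Fin rank → R)
  retr : (Fin rank → R) →ₗ[R] P
  retr_incl : ∀ p, retr (incl p) = p

theorem FreeRetract.nonempty (R P : Type u) [Ring R] [AddCommGroup P] [Module R P]
    [Module.Finite R P] [Module.Projective R P] : Nonempty (FreeRetract R P) := by
  obtain ⟨n, f, g, hf, hg, hfg⟩ := Module.Finite.exists_comp_eq_id_of_projective R P
  exact ⟨⟨n, g, f, fun p => DFunLike.congr_fun hfg p⟩⟩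

namespace FreeRetract

variable {R P P' : Type u} [Ring R] [AddCommGroup P] [Module R P] [AddCommGroup P'] [Module R P']
  (s : FreeRetract R P) (s' : FreeRetract R P')
  (M : Type u) [AddCommGroup M] [Module Rᵐᵒᵖ M]
  {M' : Type u} [AddCommGroup M'] [Module Rᵐᵒᵖ M']

/-- The coordinates `M ⊗_R P → M ^ rank`. -/
def toRow : BalancedTensor R M P →+ (Fin s.rank → M) :=
  BalancedTensor.lift
    (AddMonoidHom.mk' (fun m => AddMonoidHom.mk'
        (fun p j => MulOpposite.op (s.incl p j) • m) (fun p q => by ext; simp [add_smul]))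
      (fun m m' => by ext; simp))
    (fun m r p => by ext; simp [mul_smul])

@[simp] theorem toRow_tmul (m : M) (p : P) :
    s.toRow M (BalancedTensor.tmul R m p) = fun j => MulOpposite.op (s.incl p j) • m := rfl

/-- The element of `M ⊗_R P` with given coordinates. -/
def ofRow : (Fin s.rank → M) →+ BalancedTensor R M P where
  toFun x := ∑ j, BalancedTensor.tmul R (x j) (s.retr (Pi.single j 1))
  map_zero' := by simp [← BalancedTensor.mk_apply]
  map_add' x y := by simp [BalancedTensor.add_tmul, Finset.sum_add_distrib]

theorem ofRow_apply (x : Fin s.rank → M) :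
    s.ofRow M x = ∑ j, BalancedTensor.tmul R (x j) (s.retr (Pi.single j 1)) := rfl

theorem ofRow_toRow (t : BalancedTensor R M P) : s.ofRow M (s.toRow M t) = t := by
  have : (s.ofRow M).comp (s.toRow M) = AddMonoidHom.id _ := by
    refine BalancedTensor.hom_ext fun m p => ?_
    change s.ofRow M (s.toRow M (BalancedTensor.tmul R m p)) = BalancedTensor.tmul R m p
    rw [toRow_tmul, ofRow_apply]
    simp only [BalancedTensor.smul_tmul, ← map_smul]
    simp only [← BalancedTensor.mk_apply, ← map_sum]
    congr 1
    conv_rhs => rw [← s.retr_incl p]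
    congr 1
    ext i
    simp [Finset.sum_apply, Pi.single_apply]
  exact DFunLike.congr_fun this t

theorem toRow_injective : Function.Injective (s.toRow M) :=
  Function.LeftInverse.injective (s.ofRow_toRow M)

variable {M} in
theorem toRow_map (f : M →ₗ[Rᵐᵒᵖ] M') (t : BalancedTensor R M P) :
    s.toRow M' (BalancedTensor.map f LinearMap.id t) = f ∘ s.toRow M t := by
  have : (s.toRow M').comp (BalancedTensor.map f LinearMap.id) =
      (f.toAddMonoidHom.compLeft _).comp (s.toRow M) := by
    refine BalancedTensor.hom_ext fun m p => ?_
    ext j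
    exact (map_smul f _ _).symm
  exact DFunLike.congr_fun this t

variable {M} in
theorem map_ofRow (f : M →ₗ[Rᵐᵒᵖ] M') (x : Fin s.rank → M) :
    BalancedTensor.map f LinearMap.id (s.ofRow M x) = s.ofRow M' (f ∘ x) := by
  simp [ofRow_apply, BalancedTensor.map_tmul]

/-- The matrix of a homomorphism between retracts of free modules. -/
def matrix (g : P →ₗ[R] P') : Matrix (Fin s.rank) (Fin s'.rank) R :=
  fun i j => s'.incl (g (s.retr (Pi.single i 1))) j

theorem toRow_map_ofRow (g : P →ₗ[R] P') (x : Fin s.rank → M) :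
    s'.toRow M (BalancedTensor.map LinearMap.id g (s.ofRow M x)) =
      rowMul M (s.matrix s' g) x := by
  ext j
  simp only [ofRow_apply, map_sum, BalancedTensor.map_tmul, toRow_tmul, Finset.sum_apply]
  rfl

end FreeRetract

section Exactness

variable {R P : Type u} [Ring R] [AddCommGroup P] [Module R P]
  [Module.Finite R P] [Module.Projective R P]
  {K W M : Type u} [AddCommGroup K] [Module Rᵐᵒᵖ K] [AddCommGroup W] [Module Rᵐᵒᵖ W]
  [AddCommGroup M] [Module Rᵐᵒᵖ M] {f : K →ₗ[Rᵐᵒᵖ] W} {g : W →ₗ[Rᵐᵒᵖ] M}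

/-- In coordinates the map is `f` applied entrywise. The coordinates are only injective, not
bijective, but that is enough. -/
theorem BalancedTensor.map_injective (hf : Function.Injective f) :
    Function.Injective (BalancedTensor.map f (LinearMap.id : P →ₗ[R] P)) := by
  obtain ⟨s⟩ := FreeRetract.nonempty R P
  intro t t' h
  refine s.toRow_injective K ?_
  have := congrArg (s.toRow W) h
  rw [s.toRow_map, s.toRow_map] at this
  exact hf.comp_left this

theorem BalancedTensor.map_surjective (hg : Function.Surjective g) :
    Function.Surjective (BalancedTensor.map g (LinearMap.id : P →ₗ[R] P)) := by
  obtain ⟨s⟩ := FreeRetract.nonempty R P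
  intro t
  obtain ⟨x, hx⟩ := hg.comp_left (s.toRow M t)
  exact ⟨s.ofRow W x, by rw [s.map_ofRow, show g ∘ x = _ from hx, s.ofRow_toRow]⟩

theorem BalancedTensor.map_exact (h : Function.Exact f g) :
    Function.Exact (BalancedTensor.map f (LinearMap.id : P →ₗ[R] P))
      (BalancedTensor.map g (LinearMap.id : P →ₗ[R] P)) := by
  obtain ⟨s⟩ := FreeRetract.nonempty R P
  intro t
  constructor
  · intro ht
    have := congrArg (s.toRow M) ht
    rw [s.toRow_map, map_zero] at this
    have hk : ∀ j, ∃ k, f k = s.toRow W t j := fun j => (h _).1 (congrFun this j)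
    choose k hk using hk
    refine ⟨s.ofRow K k, ?_⟩
    rw [s.map_ofRow, show f ∘ k = _ from funext hk, s.ofRow_toRow]
  · rintro ⟨t, rfl⟩
    rw [BalancedTensor.map_comp_apply, h.linearMap_comp_eq_zero, BalancedTensor.map_zero_left]

end Exactness

/-! ### Vanishing of Tor and dimension shifting. -/

/-- A sequence `⋯ → X₂ → X₁ → X₀` of finitely generated projective left modules, exact at every
`Xᵢ` with `i > 0`. -/
structure FGProjSequence (R : Type u) [Ring R] where
  X : ℕ → Type u
  [addCommGroup : ∀ i, AddCommGroup (X i)]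
  [module : ∀ i, Module R (X i)]
  d : ∀ i, X (i + 1) →ₗ[R] X i
  [finite : ∀ i, Module.Finite R (X i)]
  [projective : ∀ i, Module.Projective R (X i)]
  exact : ∀ i, Function.Exact (d (i + 1)) (d i)

attribute [instance] FGProjSequence.addCommGroup FGProjSequence.module FGProjSequence.finite
  FGProjSequence.projective

/-- The sequence with its first term dropped. -/
def FGProjSequence.shift {R : Type u} [Ring R] (S : FGProjSequence R) : FGProjSequence R where
  X i := S.X (i + 1)
  d i := S.d (i + 1)
  exact i := S.exact (i + 1)

/-- Exactness of `M ⊗_R X` at `M ⊗_R Xᵢ₊₁`. -/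
def TensorExactAt {R : Type u} [Ring R] (S : FGProjSequence R) (M : Type u) [AddCommGroup M]
    [Module Rᵐᵒᵖ M] (i : ℕ) : Prop :=
  Function.Exact (BalancedTensor.map (LinearMap.id : M →ₗ[Rᵐᵒᵖ] M) (S.d (i + 1)))
    (BalancedTensor.map (LinearMap.id : M →ₗ[Rᵐᵒᵖ] M) (S.d i))

/-- `M ⊗_R X` is exact in degree `i + 1` for all exact sequences `X` of finitely generated
projectives. -/
def TorVanishes (R M : Type u) [Ring R] [AddCommGroup M]
    [Module Rᵐᵒᵖ M] (i : ℕ) : Prop :=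
  ∀ S : FGProjSequence R, TensorExactAt S M i

section TorVanishes

variable {R : Type u} [Ring R] {K W M : Type u} [AddCommGroup K] [Module Rᵐᵒᵖ K]
  [AddCommGroup W] [Module Rᵐᵒᵖ W] [AddCommGroup M] [Module Rᵐᵒᵖ M]

theorem FGProjSequence.map_d_map_d (S : FGProjSequence R) (i : ℕ)
    (t : BalancedTensor R M (S.X (i + 2))) :
    BalancedTensor.map (LinearMap.id : M →ₗ[Rᵐᵒᵖ] M) (S.d i)
      (BalancedTensor.map LinearMap.id (S.d (i + 1)) t) = 0 := by
  rw [BalancedTensor.map_comp_apply, (S.exact i).linearMap_comp_eq_zero,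
    BalancedTensor.map_zero_right]

theorem tensorExactAt_iff (S : FGProjSequence R) (i : ℕ) :
    TensorExactAt S M i ↔ ∀ t, BalancedTensor.map (LinearMap.id : M →ₗ[Rᵐᵒᵖ] M) (S.d i) t = 0 →
      ∃ t', BalancedTensor.map LinearMap.id (S.d (i + 1)) t' = t :=
  ⟨fun h t => (h t).1, fun h t => ⟨h t, fun ⟨t', h'⟩ => h' ▸ S.map_d_map_d i t'⟩⟩

/-- Dropping the first term of a sequence leaves a sequence of the same kind: syzygies of super
finitely presented modules are super finitely presented. -/
theorem TorVanishes.succ {i : ℕ} (h : TorVanishes R M i) : TorVanishes R M (i + 1) :=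
  fun S => h S.shift

theorem TorVanishes.mono {i j : ℕ} (h : TorVanishes R M i) (hij : i ≤ j) : TorVanishes R M j := by
  induction hij with
  | refl => exact h
  | step _ ih => exact ih.succ

/-- The part of the long exact Tor sequence around the connecting map, chased by hand. Tensoring the
short exact sequence with a projective `S.X j` keeps it exact. -/
theorem TorVanishes.of_shortExact_left {f : K →ₗ[Rᵐᵒᵖ] W} {g : W →ₗ[Rᵐᵒᵖ] M}
    (hf : Function.Injective f) (hfg : Function.Exact f g)
    (hg : Function.Surjective g) (hW : TorVanishes R W 0) {i : ℕ}
    (hM : TorVanishes R M (i + 1)) : TorVanishes R K i := by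
  intro S
  rw [tensorExactAt_iff]
  intro k hk
  obtain ⟨w, hw⟩ := (hW.mono (Nat.zero_le i) S (BalancedTensor.map f LinearMap.id k)).1 (by
    rw [← BalancedTensor.map_comm, hk, map_zero])
  obtain ⟨m, hm⟩ := (hM S (BalancedTensor.map g LinearMap.id w)).1 (by
    rw [← BalancedTensor.map_comm, hw, (BalancedTensor.map_exact hfg).apply_apply_eq_zero])
  obtain ⟨w', rfl⟩ := BalancedTensor.map_surjective hg m
  obtain ⟨k', hk'⟩ := (BalancedTensor.map_exact hfg
      (w - BalancedTensor.map LinearMap.id (S.d (i + 1 + 1)) w')).1 (by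
    rw [map_sub, ← hm, BalancedTensor.map_comm, sub_self])
  refine ⟨k', BalancedTensor.map_injective hf ?_⟩
  rw [BalancedTensor.map_comm, hk', map_sub, hw, S.map_d_map_d, sub_zero]

theorem TorVanishes.of_shortExact_right {f : K →ₗ[Rᵐᵒᵖ] W} {g : W →ₗ[Rᵐᵒᵖ] M}
    (hf : Function.Injective f) (hfg : Function.Exact f g)
    (hg : Function.Surjective g) (hW : TorVanishes R W 0) {i : ℕ}
    (hK : TorVanishes R K i) : TorVanishes R M (i + 1) := by
  intro S
  rw [tensorExactAt_iff]
  intro m hm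
  obtain ⟨w, rfl⟩ := BalancedTensor.map_surjective hg m
  obtain ⟨k, hk⟩ := (BalancedTensor.map_exact hfg
      (BalancedTensor.map LinearMap.id (S.d (i + 1)) w)).1 (by
    rw [BalancedTensor.map_comm, hm])
  obtain ⟨k', rfl⟩ := (hK S k).1 (BalancedTensor.map_injective hf (by
    rw [BalancedTensor.map_comm, hk, S.map_d_map_d, map_zero]))
  obtain ⟨w', hw'⟩ := (hW.mono (Nat.zero_le (i + 1)) S
      (w - BalancedTensor.map f LinearMap.id k')).1 (by
    rw [map_sub, ← BalancedTensor.map_comm, hk, sub_self])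
  refine ⟨BalancedTensor.map g LinearMap.id w', ?_⟩
  rw [← BalancedTensor.map_comm, hw', map_sub,
    (BalancedTensor.map_exact hfg).apply_apply_eq_zero, sub_zero]

end TorVanishes

/-! ### Purity through linear equations. -/

/-- Finite systems of homogeneous linear equations solvable in `M` can be solved compatibly
in `W`. -/
def LiftsSolutions {R : Type u} [Ring R] {W M : Type u} [AddCommGroup W] [Module Rᵐᵒᵖ W]
    [AddCommGroup M] [Module Rᵐᵒᵖ M] (g : W →ₗ[Rᵐᵒᵖ] M) : Prop :=
  ∀ (m n : ℕ) (D : Matrix (Fin m) (Fin n) R) (y : Fin m → M), rowMul M D y = 0 →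
    ∃ x : Fin m → W, g ∘ x = y ∧ rowMul W D x = 0

section LiftsSolutions

variable {R : Type u} [Ring R] {W M : Type u}
  [AddCommGroup W] [Module Rᵐᵒᵖ W] [AddCommGroup M] [Module Rᵐᵒᵖ M] {g : W →ₗ[Rᵐᵒᵖ] M}

/-- In coordinates, being a cycle in `M ⊗ X` is a finite homogeneous linear system. Hence cycles
lift to cycles in `W ⊗ X`, which are boundaries. -/
theorem LiftsSolutions.torVanishes (hg : LiftsSolutions g) {i : ℕ} (hW : TorVanishes R W i) :
    TorVanishes R M i := by
  intro S
  rw [tensorExactAt_iff]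
  intro t ht
  obtain ⟨s⟩ := FreeRetract.nonempty R (S.X (i + 1))
  obtain ⟨s'⟩ := FreeRetract.nonempty R (S.X i)
  obtain ⟨x, hx, hx'⟩ := hg _ _ (s.matrix s' (S.d i)) (s.toRow M t) (by
    rw [← s.toRow_map_ofRow, s.ofRow_toRow, ht, map_zero])
  rw [← s.toRow_map_ofRow] at hx'
  obtain ⟨w, hw⟩ := (hW S (s.ofRow W x)).1 (s'.toRow_injective W (by rw [hx', map_zero]))
  refine ⟨BalancedTensor.map g LinearMap.id w, ?_⟩
  rw [← BalancedTensor.map_comm, hw, s.map_ofRow, hx, s.ofRow_toRow]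

/-- Solutions of the system `D` are the homomorphisms out of the finitely presented module with
relations the columns of `D`. -/
theorem LiftsSolutions.of_lifts_finitePresentation
    (h : ∀ (L : Type u) [AddCommGroup L] [Module Rᵐᵒᵖ L], Module.FinitePresentation Rᵐᵒᵖ L →
      ∀ f : L →ₗ[Rᵐᵒᵖ] M, ∃ f' : L →ₗ[Rᵐᵒᵖ] W, g ∘ₗ f' = f) : LiftsSolutions g := by
  intro m n D y hy
  let c : Fin n → Fin m → Rᵐᵒᵖ := fun j i => MulOpposite.op (D i j)
  let N : Submodule Rᵐᵒᵖ (Fin m → Rᵐᵒᵖ) := Submodule.span Rᵐᵒᵖ (Set.range c)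
  have hN : N.FG := ⟨(Set.range c).toFinite.toFinset, by simp [N]⟩
  have hL : Module.FinitePresentation Rᵐᵒᵖ ((Fin m → Rᵐᵒᵖ) ⧸ N) :=
    Module.finitePresentation_of_surjective N.mkQ N.mkQ_surjective (by rwa [Submodule.ker_mkQ])
  let φ : (Fin m → Rᵐᵒᵖ) →ₗ[Rᵐᵒᵖ] M := Fintype.linearCombination Rᵐᵒᵖ y
  have hφ : N ≤ φ.ker := by
    refine Submodule.span_le.2 ?_
    rintro _ ⟨j, rfl⟩
    exact congrFun hy j
  obtain ⟨f', hf'⟩ := h _ hL (N.liftQ φ hφ)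
  refine ⟨fun i => f' (N.mkQ (Pi.single i 1)), ?_, ?_⟩
  · ext i
    have := DFunLike.congr_fun hf' (N.mkQ (Pi.single i 1))
    refine this.trans ?_
    simp [φ, Fintype.linearCombination_apply_single]
  · ext j
    simp only [rowMul_apply, ← map_smul, ← map_sum]
    have : N.mkQ (∑ i, MulOpposite.op (D i j) • Pi.single i 1) = 0 := by
      rw [Submodule.mkQ_apply, Submodule.Quotient.mk_eq_zero]
      refine Submodule.subset_span ⟨j, ?_⟩
      ext i
      simp [c, Finset.sum_apply, Pi.single_apply]
    rw [this, map_zero]; rfl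

theorem LiftsSolutions.exists_lift (hg : LiftsSolutions g) {L : Type u} [AddCommGroup L]
    [Module Rᵐᵒᵖ L] [Module.FinitePresentation Rᵐᵒᵖ L] (f : L →ₗ[Rᵐᵒᵖ] M) :
    ∃ f' : L →ₗ[Rᵐᵒᵖ] W, g ∘ₗ f' = f := by
  obtain ⟨m, π, hπ⟩ := Module.Finite.exists_fin' Rᵐᵒᵖ L
  have hk : (LinearMap.ker π).FG := Module.FinitePresentation.fg_ker π hπ
  obtain ⟨n, c, hc⟩ := Submodule.fg_iff_exists_fin_generating_family.1 hk
  let y : Fin m → M := fun i => f (π (Pi.single i 1))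
  have hlin : ∀ v, f (π v) = ∑ i, v i • y i := fun v => by
    simp only [y, ← map_smul, ← map_sum]
    congr 2
    ext i
    simp [Finset.sum_apply, Pi.single_apply]
  obtain ⟨x, hx, hx'⟩ := hg m n (Matrix.of fun i j => (c j i).unop) y (by
    ext j
    have : c j ∈ LinearMap.ker π := hc ▸ Submodule.subset_span ⟨j, rfl⟩
    simp only [rowMul_apply, Matrix.of_apply, MulOpposite.op_unop, ← hlin,
      LinearMap.mem_ker.1 this, map_zero]
    rfl)
  have hker : LinearMap.ker π ≤ LinearMap.ker (Fintype.linearCombination Rᵐᵒᵖ x) := by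
    rw [← hc, Submodule.span_le]
    rintro _ ⟨j, rfl⟩
    exact congrFun hx' j
  refine ⟨(LinearMap.ker π).liftQ _ hker ∘ₗ (π.quotKerEquivOfSurjective hπ).symm.toLinearMap, ?_⟩
  refine LinearMap.ext fun l => ?_
  obtain ⟨v, rfl⟩ := hπ l
  have hv : (π.quotKerEquivOfSurjective hπ).symm (π v) = Submodule.Quotient.mk v := by
    rw [LinearEquiv.symm_apply_eq]; rfl
  simp [hv, Fintype.linearCombination_apply, hlin, ← hx]

/-- A lift `x` of `y` gives `x D = i a`. Injectivity after tensoring with the left module `R ^ n`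
modulo the rows of `D` forces `a = α D`, so `x - i α` is a lift that solves the system. -/
theorem IsPureShortExact.liftsSolutions {A : Type u} [AddCommGroup A] [Module Rᵐᵒᵖ A]
    {i : A →ₗ[Rᵐᵒᵖ] W} (h : IsPureShortExact i g) : LiftsSolutions g := by
  obtain ⟨⟨-, hex, hsurj⟩, htensor⟩ := h
  intro m n D y hy
  obtain ⟨x, rfl⟩ := hsurj.comp_left y
  have ha : ∀ j, ∃ a, i a = rowMul W D x j := fun j => (hex _).1 (by
    rw [rowMul_comp] at hy; exact congrFun hy j)
  choose a ha using ha
  let N : Submodule R (Fin n → R) := Submodule.span R (Set.range D)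
  let e : Fin n → (Fin n → R) ⧸ N := fun j => N.mkQ (Pi.single j 1)
  have hD : ∀ k, ∑ j, D k j • e j = 0 := fun k => by
    simp only [e, ← map_smul, ← map_sum]
    rw [Submodule.mkQ_apply, Submodule.Quotient.mk_eq_zero]
    refine Submodule.subset_span ⟨k, ?_⟩
    ext i
    simp [Finset.sum_apply, Pi.single_apply]
  have hzero : ∑ j, BalancedTensor.tmul R (a j) (e j) = 0 := by
    refine (htensor ((Fin n → R) ⧸ N)).1 ?_
    rw [map_zero, map_sum]
    simp only [BalancedTensor.map_tmul, ha, rowMul_apply]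
    simp only [← BalancedTensor.mk_apply, map_sum, AddMonoidHom.finsetSum_apply]
    rw [Finset.sum_comm]
    refine Finset.sum_eq_zero fun k _ => ?_
    simp only [BalancedTensor.mk_apply, LinearMap.id_apply, BalancedTensor.smul_tmul]
    simp only [← BalancedTensor.mk_apply, ← map_sum, hD, map_zero]
  let B : AddSubgroup (Fin n → A) := (rowMul A D).range
  -- This pairing induces the map from `A ⊗ (R ^ n / rows of D)` to `A ^ n / A ^ m D` that sends `∑
  -- a j ⊗ e j` to the class of `a`.
  let ψ : A →+ (Fin n → R) →+ (Fin n → A) ⧸ B :=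
    AddMonoidHom.mk' (fun α => (QuotientAddGroup.mk' B).comp (AddMonoidHom.mk'
        (fun q j => MulOpposite.op (q j) • α) (fun p q => by ext; simp [add_smul])))
      (fun α β => by
        ext q
        simp only [AddMonoidHom.comp_apply, AddMonoidHom.mk'_apply, AddMonoidHom.add_apply,
          ← map_add]
        congr 1
        ext; simp)
  have hψ : ∀ α, N.toAddSubgroup ≤ (ψ α).ker := fun α q hq => by
    induction hq using Submodule.span_induction generalizing α with
    | mem q hq =>
      obtain ⟨k, rfl⟩ := hq
      refine (QuotientAddGroup.eq_zero_iff _).2 ⟨Pi.single k α, ?_⟩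
      ext j
      rw [rowMul_apply, Finset.sum_eq_single k (by
        intro b _ hb; rw [Pi.single_eq_of_ne hb, smul_zero]) (by simp)]
      simp
    | zero => exact map_zero _
    | add p q _ _ hp hq => exact (ψ α).ker.add_mem (hp α) (hq α)
    | smul r q _ hq =>
      refine Eq.trans ?_ (hq (MulOpposite.op r • α))
      change QuotientAddGroup.mk' B _ = QuotientAddGroup.mk' B _
      congr 1
      ext j
      simp [mul_smul]
  let Ψ : BalancedTensor R A ((Fin n → R) ⧸ N) →+ (Fin n → A) ⧸ B :=
    BalancedTensor.lift (AddMonoidHom.mk'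
        (fun α => QuotientAddGroup.lift N.toAddSubgroup (ψ α) (hψ α))
        (fun α β => by
          refine AddMonoidHom.ext fun q => ?_
          obtain ⟨q, rfl⟩ := N.mkQ_surjective q
          exact DFunLike.congr_fun (map_add ψ α β) q))
      (fun α r q => by
        obtain ⟨q, rfl⟩ := N.mkQ_surjective q
        change QuotientAddGroup.mk' B _ = QuotientAddGroup.mk' B _
        congr 1
        ext j
        simp [mul_smul])
  have hΨ := congrArg Ψ hzero
  rw [map_zero, map_sum] at hΨ
  have hΨ' : QuotientAddGroup.mk' B a = 0 := by
    rw [← hΨ]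
    have : ∀ j, Ψ (BalancedTensor.tmul R (a j) (e j)) =
        QuotientAddGroup.mk' B (Pi.single j (a j)) := fun j => by
      change QuotientAddGroup.mk' B _ = QuotientAddGroup.mk' B _
      congr 1
      ext k
      by_cases hk : k = j
      · subst hk; simp
      · simp [hk]
    simp only [this, ← map_sum, Finset.univ_sum_single]
  obtain ⟨α, hα⟩ := (QuotientAddGroup.eq_zero_iff _).1 hΨ'
  refine ⟨x - i ∘ α, ?_, ?_⟩
  · ext k
    simp [hex.apply_apply_eq_zero]
  · rw [map_sub, rowMul_comp, hα]
    ext j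
    simp [ha]

theorem isPureProjective_of_finitePresentation (L : Type u) [AddCommGroup L] [Module Rᵐᵒᵖ L]
    [Module.FinitePresentation Rᵐᵒᵖ L] : IsPureProjective R L := by
  intro A B C _ _ _ _ _ _ i p h
  obtain ⟨hi, hip, -⟩ := h.1
  refine ⟨fun f f' hf => LinearMap.ext fun l => hi (DFunLike.congr_fun hf l), fun f => ⟨?_, ?_⟩,
    fun f => h.liftsSolutions.exists_lift f⟩
  · intro hf
    have : LinearMap.range f ≤ LinearMap.range i := by
      rintro _ ⟨l, rfl⟩
      exact (hip _).1 (DFunLike.congr_fun hf l)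
    refine ⟨(LinearEquiv.ofInjective i hi).symm.toLinearMap ∘ₗ
      f.codRestrict (LinearMap.range i) (fun l => this ⟨l, rfl⟩), ?_⟩
    refine LinearMap.ext fun l => ?_
    exact congrArg Subtype.val ((LinearEquiv.ofInjective i hi).apply_symm_apply _)
  · rintro ⟨f, rfl⟩
    exact LinearMap.ext fun l => hip.apply_apply_eq_zero _

end LiftsSolutions

/-! ### Comparison with the derived functor Tor and the weak flat dimension. -/

theorem subsingleton_rightLeftTor_succ_iff {R M : Type u} [Ring R] [AddCommGroup M]
    [Module Rᵐᵒᵖ M] {N : ModuleCat.{u} R} (F : ProjectiveResolution N) (i : ℕ) :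
    Subsingleton (rightLeftTor R M (i + 1) N) ↔
      Function.Exact
        (BalancedTensor.map (LinearMap.id : M →ₗ[Rᵐᵒᵖ] M) (F.complex.d (i + 2) (i + 1)).hom)
        (BalancedTensor.map (LinearMap.id : M →ₗ[Rᵐᵒᵖ] M) (F.complex.d (i + 1) i).hom) := by
  rw [← AddCommGrpCat.isZero_iff_subsingleton, rightLeftTor,
    (F.isoLeftDerivedObj (balancedTensorFunctor R M) (i + 1)).isZero_iff,
    HomologicalComplex.homologyFunctor_obj, ← HomologicalComplex.exactAt_iff_isZero_homology,
    HomologicalComplex.exactAt_iff' _ (i + 2) (i + 1) i (by simp) (by simp),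
    ShortComplex.ab_exact_iff_function_exact]
  rfl

namespace FGProjSequence

variable {R : Type u} [Ring R]

/-- The exact sequence underlying a resolution by finitely generated projective modules. -/
def ofResolution {N : ModuleCat.{u} R} (F : ProjectiveResolution N)
    (hF : ∀ i, Module.Finite R (F.complex.X i)) : FGProjSequence R where
  X i := F.complex.X i
  d i := (F.complex.d (i + 1) i).hom
  finite := hF
  projective i := (IsProjective.iff_projective (R := R) (P := F.complex.X i)).2 (F.projective i)
  exact i := (ShortComplex.ShortExact.moduleCat_exact_iff_function_exact _).1 (F.exact_succ i)

variable (S : FGProjSequence R)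

/-- The chain complex underlying a sequence of finitely generated projective modules. -/
def complex : ChainComplex (ModuleCat.{u} R) ℕ :=
  ChainComplex.of (fun i => ModuleCat.of R (S.X i)) (fun i => ModuleCat.ofHom (S.d i))
    (fun i => by rw [← ModuleCat.ofHom_comp, (S.exact i).linearMap_comp_eq_zero]; rfl)

theorem complex_d (i : ℕ) : S.complex.d (i + 1) i = ModuleCat.ofHom (S.d i) :=
  ChainComplex.of_d (fun i => ModuleCat.of R (S.X i)) (fun i => ModuleCat.ofHom (S.d i)) i

/-- The module resolved by a sequence of finitely generated projective modules. -/
abbrev coker : ModuleCat.{u} R := ModuleCat.of R (S.X 0 ⧸ LinearMap.range (S.d 0))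

/-- The augmentation of the resolution given by `S`. -/
def augmentation : S.complex ⟶ (ChainComplex.single₀ (ModuleCat.{u} R)).obj S.coker :=
  (ChainComplex.toSingle₀Equiv _ _).symm
    ⟨ModuleCat.ofHom (LinearMap.range (S.d 0)).mkQ, by
      rw [complex_d]
      refine ModuleCat.hom_ext (LinearMap.ext fun x => ?_)
      exact (Submodule.Quotient.mk_eq_zero _).2 ⟨x, rfl⟩⟩

instance quasiIso_augmentation : QuasiIso S.augmentation where
  quasiIsoAt m := by
    induction m with
    | zero =>
      rw [ChainComplex.quasiIsoAt₀_iff, ShortComplex.quasiIso_iff_of_zeros' _ rfl rfl rfl]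
      constructor
      · rw [ShortComplex.ShortExact.moduleCat_exact_iff_function_exact]
        change Function.Exact (S.complex.d (0 + 1) 0).hom (LinearMap.range (S.d 0)).mkQ
        rw [complex_d]
        exact LinearMap.exact_map_mkQ_range (S.d 0)
      · rw [ModuleCat.epi_iff_surjective]
        exact (LinearMap.range (S.d 0)).mkQ_surjective
    | succ m _ =>
      rw [quasiIsoAt_iff_exactAt' (hL := ChainComplex.exactAt_succ_single_obj ..),
        HomologicalComplex.exactAt_iff' _ (m + 2) (m + 1) m (by simp) (by simp),
        ShortComplex.ShortExact.moduleCat_exact_iff_function_exact]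
      simp only [HomologicalComplex.shortComplexFunctor'_obj_f,
        HomologicalComplex.shortComplexFunctor'_obj_g, HomologicalComplex.sc', complex_d]
      exact S.exact m

/-- The resolution by finitely generated projective modules given by `S`. -/
def resolution : ProjectiveResolution S.coker where
  complex := S.complex
  projective i := (IsProjective.iff_projective (R := R) (P := S.X i)).1 (S.projective i)
  π := S.augmentation

end FGProjSequence

/-- Any resolution computes Tor, and every `FGProjSequence` resolves the cokernel of its last map.
-/
theorem torVanishes_iff (R M : Type u) [Ring R] [AddCommGroup M] [Module Rᵐᵒᵖ M] (i : ℕ) :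
    TorVanishes R M i ↔ ∀ N : ModuleCat.{u} R, IsSuperFinitelyPresented N →
      Subsingleton (rightLeftTor R M (i + 1) N) := by
  constructor
  · rintro h N ⟨F, hF⟩
    exact (subsingleton_rightLeftTor_succ_iff F i).2 (h (FGProjSequence.ofResolution F hF))
  · intro h S
    have := (subsingleton_rightLeftTor_succ_iff S.resolution i).1
      (h _ ⟨S.resolution, fun i => S.finite i⟩)
    have h1 := S.complex_d (i + 1)
    have h2 := S.complex_d i
    change Function.Exact
      (BalancedTensor.map (LinearMap.id : M →ₗ[Rᵐᵒᵖ] M) (S.complex.d (i + 1 + 1) (i + 1)).hom)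
      (BalancedTensor.map (LinearMap.id : M →ₗ[Rᵐᵒᵖ] M) (S.complex.d (i + 1) i).hom) at this
    rw [h1, h2] at this
    exact this

theorem isWeakFlat_iff (R M : Type u) [Ring R] [AddCommGroup M] [Module Rᵐᵒᵖ M] :
    IsWeakFlat R M ↔ TorVanishes R M 0 :=
  (torVanishes_iff R M 0).symm

theorem weakFlatDim_le_iff (R M : Type u) [Ring R] [AddCommGroup M] [Module Rᵐᵒᵖ M] (n : ℕ) :
    weakFlatDim R M ≤ n ↔ TorVanishes R M n := by
  constructor
  · intro h
    have hne : {d : ℕ∞ | ∃ n : ℕ, d = n ∧ ∀ N : ModuleCat.{u} R, IsSuperFinitelyPresented N →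
        Subsingleton (rightLeftTor R M (n + 1) N)}.Nonempty := by
      by_contra hempty
      rw [weakFlatDim, Set.not_nonempty_iff_eq_empty.1 hempty, sInf_empty] at h
      exact ENat.natCast_ne_top n (top_le_iff.1 h)
    obtain ⟨m, hm, hm'⟩ := csInf_mem hne
    refine ((torVanishes_iff R M m).2 hm').mono ?_
    rw [weakFlatDim, hm] at h
    exact_mod_cast h
  · intro h
    exact sInf_le ⟨n, rfl, (torVanishes_iff R M n).1 h⟩

/-- The target may lie in any universe, as needed for characters with values in `AddCircle (1 : ℚ)`.
-/
theorem BalancedTensor.hom_ext_of_tmul {R M N : Type u} {A : Type*} [Ring R] [AddCommGroup M]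
    [Module Rᵐᵒᵖ M] [AddCommGroup N] [Module R N] [AddCommGroup A]
    {f g : BalancedTensor R M N →+ A}
    (h : ∀ (m : M) (n : N), f (BalancedTensor.tmul R m n) = g (BalancedTensor.tmul R m n)) :
    f = g := by
  refine QuotientAddGroup.addMonoidHom_ext _ (AddMonoidHom.ext fun x => ?_)
  induction x using TensorProduct.induction_on with
  | zero => rw [map_zero, map_zero]
  | tmul m n => exact h m n
  | add x y hx hy => rw [map_add, map_add, hx, hy]

/-! ### Closure properties of pure submodules. -/

/-- A submodule is pure if every finite system of linear equations with constants in it that is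
solvable in the ambient module is solvable in the submodule. -/
def IsPureSubmodule {R X : Type u} [Ring R] [AddCommGroup X] [Module Rᵐᵒᵖ X]
    (U : Submodule Rᵐᵒᵖ X) : Prop :=
  ∀ (m n : ℕ) (D : Matrix (Fin m) (Fin n) R) (x : Fin m → X), (∀ j, rowMul X D x j ∈ U) →
    ∃ u : Fin m → X, (∀ i, u i ∈ U) ∧ rowMul X D u = rowMul X D x

section IsPureSubmodule

variable {R X Y : Type u} [Ring R] [AddCommGroup X] [Module Rᵐᵒᵖ X] [AddCommGroup Y]
  [Module Rᵐᵒᵖ Y] {U : Submodule Rᵐᵒᵖ X}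

theorem IsPureSubmodule.liftsSolutions (hU : IsPureSubmodule U) : LiftsSolutions U.mkQ := by
  intro m n D y hy
  obtain ⟨x, rfl⟩ := U.mkQ_surjective.comp_left y
  obtain ⟨u, hu, hux⟩ := hU m n D x fun j => by
    rw [rowMul_comp] at hy
    exact (Submodule.Quotient.mk_eq_zero U).1 (congrFun hy j)
  refine ⟨x - u, ?_, by rw [map_sub, hux, sub_self]⟩
  ext i
  simp [(Submodule.Quotient.mk_eq_zero U).2 (hu i)]

theorem IsPureSubmodule.torVanishes_quotient (hU : IsPureSubmodule U) {i : ℕ}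
    (hX : TorVanishes R X i) : TorVanishes R (X ⧸ U) i :=
  hU.liftsSolutions.torVanishes hX

theorem IsPureSubmodule.torVanishes (hU : IsPureSubmodule U)
    (hX : TorVanishes R X 0) : TorVanishes R U 0 :=
  TorVanishes.of_shortExact_left U.injective_subtype (LinearMap.exact_subtype_mkQ U)
    U.mkQ_surjective hX (hU.torVanishes_quotient hX).succ

theorem TorVanishes.of_equiv {i : ℕ} (hX : TorVanishes R X i) (e : X ≃ₗ[Rᵐᵒᵖ] Y) :
    TorVanishes R Y i := by
  refine LiftsSolutions.torVanishes (g := e.toLinearMap) (fun m n D y hy => ?_) hX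
  refine ⟨e.symm.toLinearMap ∘ y, ?_, ?_⟩
  · ext i; simp
  · rw [rowMul_comp, hy]; ext; simp

theorem isPureSubmodule_bot : IsPureSubmodule (⊥ : Submodule Rᵐᵒᵖ X) := by
  intro m n D x hx
  refine ⟨0, fun _ => Submodule.zero_mem _, ?_⟩
  rw [map_zero]
  exact funext fun j => ((Submodule.mem_bot _).1 (hx j)).symm

/-- Solve modulo `U` first; the remaining error is a system with constants in `U`, solvable in `U`.
-/
theorem IsPureSubmodule.comap_mkQ (hU : IsPureSubmodule U) {V : Submodule Rᵐᵒᵖ (X ⧸ U)}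
    (hV : IsPureSubmodule V) : IsPureSubmodule (V.comap U.mkQ) := by
  intro m n D x hx
  obtain ⟨w, hw, hwx⟩ := hV m n D (U.mkQ ∘ x) fun j => by rw [rowMul_comp]; exact hx j
  obtain ⟨v, rfl⟩ := U.mkQ_surjective.comp_left w
  obtain ⟨u, hu, hux⟩ := hU m n D (x - v) fun j => by
    rw [← Submodule.Quotient.mk_eq_zero U, map_sub]
    have := congrFun hwx j
    rw [rowMul_comp] at this
    rw [rowMul_comp] at this
    change U.mkQ (rowMul X D x j - rowMul X D v j) = 0
    rw [map_sub, sub_eq_zero]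
    exact this.symm
  refine ⟨u + v, fun i => ?_, by rw [map_add, hux, map_sub, sub_add_cancel]⟩
  change U.mkQ (u i + v i) ∈ V
  rw [map_add, show U.mkQ (u i) = 0 from (Submodule.Quotient.mk_eq_zero U).2 (hu i), zero_add]
  exact hw i

/-- The finitely many constants of a system already lie in one member of the directed family. -/
theorem isPureSubmodule_sSup {c : Set (Submodule Rᵐᵒᵖ X)} (hne : c.Nonempty)
    (hc : DirectedOn (· ≤ ·) c) (h : ∀ U ∈ c, IsPureSubmodule U) : IsPureSubmodule (sSup c) := by
  intro m n D x hx
  have : ∃ U ∈ c, ∀ j, rowMul X D x j ∈ U := by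
    have hj : ∀ j, ∃ U ∈ c, rowMul X D x j ∈ U := fun j =>
      (Submodule.mem_sSup_of_directed hne hc).1 (hx j)
    choose U hU hxU using hj
    have := hne.to_subtype
    obtain ⟨V, hUV⟩ := (directedOn_iff_directed.1 hc).finite_le (fun j => ⟨U j, hU j⟩)
    exact ⟨V, V.2, fun j => hUV j (hxU j)⟩
  obtain ⟨U, hU, hxU⟩ := this
  obtain ⟨u, hu, hux⟩ := h U hU m n D x hxU
  exact ⟨u, fun i => le_sSup hU (hu i), hux⟩

end IsPureSubmodule

/-! ### Pure submodules of bounded size: terms depend on `R` only, not on the module. -/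

/-- Terms built from a variable by linear combinations and by solving linear equations. -/
inductive SolutionTerm (R : Type u) : Type u
  | var : SolutionTerm R
  | add : SolutionTerm R → SolutionTerm R → SolutionTerm R
  | smul : R → SolutionTerm R → SolutionTerm R
  | sol (m n : ℕ) (D : Matrix (Fin m) (Fin n) R) (u : Fin n → SolutionTerm R) (i : Fin m) :
      SolutionTerm R

namespace SolutionTerm

variable {R X : Type u} [Ring R] [AddCommGroup X] [Module Rᵐᵒᵖ X]

open Classical in
/-- The value of a term in a right module. -/
def eval (x : X) : SolutionTerm R → X
  | var => x
  | add s t => eval x s + eval x t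
  | smul r t => MulOpposite.op r • eval x t
  | sol _ _ D u i =>
    -- The value `0` for unsolvable systems is arbitrary; purity only concerns solvable ones.
    if h : ∃ y, rowMul X D y = fun j => eval x (u j) then h.choose i else 0

/-- The pure submodule of values of terms at `x`. -/
def values (R : Type u) [Ring R] [Module Rᵐᵒᵖ X] (x : X) : Submodule Rᵐᵒᵖ X where
  carrier := Set.range (eval (R := R) x)
  add_mem' := by
    rintro _ _ ⟨s, rfl⟩ ⟨t, rfl⟩
    exact ⟨add s t, by rw [eval]⟩
  zero_mem' := ⟨smul 0 var, by rw [eval, MulOpposite.op_zero, zero_smul]⟩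
  smul_mem' := by
    rintro r _ ⟨t, rfl⟩
    exact ⟨smul r.unop t, by rw [eval, MulOpposite.op_unop]⟩

theorem self_mem_values (x : X) : x ∈ values R x := ⟨var, by rw [eval]⟩

theorem isPureSubmodule_values (x : X) : IsPureSubmodule (values R x) := by
  intro m n D y hy
  choose t ht using hy
  have h : ∃ y, rowMul X D y = fun j => eval x (t j) := ⟨y, funext fun j => (ht j).symm⟩
  refine ⟨h.choose, fun i => ⟨sol m n D t i, by rw [eval, dif_pos h]⟩, ?_⟩
  rw [h.choose_spec]
  exact funext ht

theorem range_linearCombination_eval (x : X) :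
    LinearMap.range (Finsupp.linearCombination Rᵐᵒᵖ (eval (R := R) x)) = values R x := by
  rw [Finsupp.range_linearCombination]
  exact Submodule.span_eq (values R x)

end SolutionTerm

/-! ### Character modules: weak flatness as a lifting property. -/

theorem AddMonoidHom.exists_comp_eq_of_ker_le {A B : Type u} [AddCommGroup A] [AddCommGroup B]
    (q : A →+ B) (χ : A →+ AddCircle (1 : ℚ)) (h : q.ker ≤ χ.ker) :
    ∃ χ' : B →+ AddCircle (1 : ℚ), χ'.comp q = χ := by
  obtain ⟨χ', hχ'⟩ := (Module.Baer.of_divisible (AddCircle (1 : ℚ))).extension_property_addMonoidHom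
    (QuotientAddGroup.kerLift q) (QuotientAddGroup.kerLift_injective q)
    (QuotientAddGroup.lift q.ker χ h)
  exact ⟨χ', AddMonoidHom.ext fun a =>
    DFunLike.congr_fun hχ' (QuotientAddGroup.mk a : A ⧸ q.ker)⟩

/-- The character module of a left module, a right module. -/
def RightCharacters (P : Type u) [AddCommGroup P] : Type u := P →+ AddCircle (1 : ℚ)

namespace RightCharacters

variable {R P P' V : Type u} [Ring R] [AddCommGroup P] [Module R P] [AddCommGroup P'] [Module R P']
  [AddCommGroup V] [Module Rᵐᵒᵖ V]

instance : AddCommGroup (RightCharacters P) := inferInstanceAs (AddCommGroup (P →+ _))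

instance : FunLike (RightCharacters P) P (AddCircle (1 : ℚ)) :=
  inferInstanceAs (FunLike (P →+ _) P _)

instance : AddMonoidHomClass (RightCharacters P) P (AddCircle (1 : ℚ)) :=
  inferInstanceAs (AddMonoidHomClass (P →+ _) P _)

@[ext] theorem ext {c c' : RightCharacters P} (h : ∀ p, c p = c' p) : c = c' := DFunLike.ext _ _ h

instance : Module Rᵐᵒᵖ (RightCharacters P) where
  smul r c := AddMonoidHom.comp c (DistribSMul.toAddMonoidHom P r.unop)
  one_smul c := ext fun p => congrArg c (one_smul R p)
  mul_smul r s c := ext fun p => congrArg c (mul_smul s.unop r.unop p)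
  smul_zero _ := rfl
  smul_add _ _ _ := rfl
  add_smul r s c := ext fun p =>
    (congrArg c (add_smul r.unop s.unop p)).trans (map_add c _ _)
  zero_smul c := ext fun p => (congrArg c (zero_smul R p)).trans (map_zero c)

/-- The homomorphism of character modules induced by a homomorphism. -/
def map (g : P →ₗ[R] P') : RightCharacters P' →ₗ[Rᵐᵒᵖ] RightCharacters P where
  toFun c := AddMonoidHom.comp c g.toAddMonoidHom
  map_add' _ _ := rfl
  map_smul' r c := ext fun p => congrArg c (map_smul g r.unop p).symm

@[simp] theorem map_apply (g : P →ₗ[R] P') (c : RightCharacters P') (p : P) :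
    map g c p = c (g p) := rfl

/-- The character of `V ⊗_R P` given by a homomorphism from `V` to the characters of `P`. -/
def uncurry (c : V →ₗ[Rᵐᵒᵖ] RightCharacters P) : BalancedTensor R V P →+ AddCircle (1 : ℚ) :=
  BalancedTensor.lift (A := AddCircle (1 : ℚ)) (c.toAddMonoidHom : V →+ (P →+ AddCircle (1 : ℚ)))
    (fun v r p => DFunLike.congr_fun (map_smul c (MulOpposite.op r) v) p)

/-- The homomorphism from `V` to the characters of `P` given by a character of `V ⊗_R P`. -/
def curry (χ : BalancedTensor R V P →+ AddCircle (1 : ℚ)) : V →ₗ[Rᵐᵒᵖ] RightCharacters P where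
  toFun v := χ.comp (BalancedTensor.mk R V P v)
  map_add' v w := ext fun p => by
    change χ (BalancedTensor.tmul R (v + w) p) = _
    rw [BalancedTensor.add_tmul, map_add]; rfl
  map_smul' r v := ext fun p => congrArg χ (BalancedTensor.smul_tmul v r.unop p)

/-- By adjunction these are characters of `U ⊗ P`, which embeds in `V ⊗ P`; characters extend
because the target is divisible. -/
theorem exists_extension [Module.Finite R P] [Module.Projective R P] {U : Submodule Rᵐᵒᵖ V}
    (c : U →ₗ[Rᵐᵒᵖ] RightCharacters P) :
    ∃ c' : V →ₗ[Rᵐᵒᵖ] RightCharacters P, c' ∘ₗ U.subtype = c := by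
  obtain ⟨χ, hχ⟩ := AddMonoidHom.exists_comp_eq_of_ker_le
    (BalancedTensor.map U.subtype (LinearMap.id : P →ₗ[R] P)) (uncurry c) (by
      rw [(AddMonoidHom.ker_eq_bot_iff _).2 (BalancedTensor.map_injective U.injective_subtype)]
      exact bot_le)
  exact ⟨curry χ, LinearMap.ext fun u => ext fun p =>
    DFunLike.congr_fun hχ (BalancedTensor.tmul R u p)⟩

end RightCharacters

namespace FGProjSequence

variable {R V : Type u} [Ring R] [AddCommGroup V] [Module Rᵐᵒᵖ V] (S : FGProjSequence R)

/-- The characters of `X₁` that vanish on the image of `X₂`. -/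
def dualCycles : Submodule Rᵐᵒᵖ (RightCharacters (S.X 1)) :=
  LinearMap.ker (RightCharacters.map (S.d 1))

theorem mem_dualCycles {c : RightCharacters (S.X 1)} :
    c ∈ S.dualCycles ↔ ∀ p, c (S.d 1 p) = 0 :=
  ⟨fun h p => DFunLike.congr_fun h p, fun h => RightCharacters.ext h⟩

/-- The homomorphism from the characters of `X₀` to the characters of `X₁` that vanish on the
image of `X₂`. -/
def dualMap : RightCharacters (S.X 0) →ₗ[Rᵐᵒᵖ] S.dualCycles :=
  (RightCharacters.map (S.d 0)).codRestrict _ fun c => S.mem_dualCycles.2 fun p => by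
    rw [RightCharacters.map_apply, (S.exact 0).apply_apply_eq_zero, map_zero]

/-- By adjunction `c` is a character of `V ⊗ X₁` vanishing on boundaries. By exactness it vanishes
on cycles, so it factors through `V ⊗ X₀`. -/
theorem exists_dualMap_comp_eq (h : TensorExactAt S V 0) (c : V →ₗ[Rᵐᵒᵖ] S.dualCycles) :
    ∃ c' : V →ₗ[Rᵐᵒᵖ] RightCharacters (S.X 0), S.dualMap ∘ₗ c' = c := by
  obtain ⟨χ, hχ⟩ := AddMonoidHom.exists_comp_eq_of_ker_le
    (BalancedTensor.map (LinearMap.id : V →ₗ[Rᵐᵒᵖ] V) (S.d 0))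
    (RightCharacters.uncurry (S.dualCycles.subtype ∘ₗ c)) (by
      intro t ht
      obtain ⟨t', rfl⟩ := (h t).1 ht
      have : (RightCharacters.uncurry (S.dualCycles.subtype ∘ₗ c)).comp
          (BalancedTensor.map LinearMap.id (S.d 1)) = 0 :=
        BalancedTensor.hom_ext_of_tmul fun v p => S.mem_dualCycles.1 (c v).2 p
      exact DFunLike.congr_fun this t')
  exact ⟨RightCharacters.curry χ, LinearMap.ext fun v => Subtype.ext <|
    RightCharacters.ext fun p => DFunLike.congr_fun hχ (BalancedTensor.tmul R v p)⟩

theorem tensorExactAt_of_dualMap (h : ∀ c : V →ₗ[Rᵐᵒᵖ] S.dualCycles,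
    ∃ c' : V →ₗ[Rᵐᵒᵖ] RightCharacters (S.X 0), S.dualMap ∘ₗ c' = c) : TensorExactAt S V 0 := by
  rw [tensorExactAt_iff]
  intro t ht
  by_contra hne
  let B := (BalancedTensor.map (LinearMap.id : V →ₗ[Rᵐᵒᵖ] V) (S.d 1)).range
  -- A cycle that is not a boundary is detected by a character killing all boundaries; lifting that
  -- character through `V ⊗ X₀` makes it vanish on the cycle.
  obtain ⟨χ, hχ⟩ := CharacterModule.exists_character_apply_ne_zero_of_ne_zero
    (a := (QuotientAddGroup.mk' B t)) (fun h0 => hne ((QuotientAddGroup.eq_zero_iff t).1 h0))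
  let χ' : BalancedTensor R V (S.X 1) →+ AddCircle (1 : ℚ) :=
    AddMonoidHom.comp χ (QuotientAddGroup.mk' B)
  obtain ⟨c', hc'⟩ := h ((RightCharacters.curry χ').codRestrict S.dualCycles fun v =>
    S.mem_dualCycles.2 fun p => by
      have : QuotientAddGroup.mk' B (BalancedTensor.tmul R v (S.d 1 p)) = 0 :=
        (QuotientAddGroup.eq_zero_iff _).2 ⟨BalancedTensor.tmul R v p, rfl⟩
      exact (congrArg χ this).trans (map_zero χ))
  have : (RightCharacters.uncurry c').comp (BalancedTensor.map LinearMap.id (S.d 0)) = χ' :=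
    BalancedTensor.hom_ext_of_tmul fun v p => by
      have := congrArg Subtype.val (LinearMap.congr_fun hc' v)
      exact DFunLike.congr_fun this p
  refine hχ ((DFunLike.congr_fun this t).symm.trans ?_)
  rw [AddMonoidHom.comp_apply, ht, map_zero]

/-- Extend `a` to `V` arbitrarily. The error `b - S.dualMap ∘ₗ a'` vanishes on `U`, so it lives on
`V ⧸ U`, where weak flatness lifts it. -/
theorem exists_lift_dualMap {U : Submodule Rᵐᵒᵖ V} (hU : TorVanishes R (V ⧸ U) 0)
    (a : U →ₗ[Rᵐᵒᵖ] RightCharacters (S.X 0)) (b : V →ₗ[Rᵐᵒᵖ] S.dualCycles)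
    (hab : S.dualMap ∘ₗ a = b ∘ₗ U.subtype) :
    ∃ l : V →ₗ[Rᵐᵒᵖ] RightCharacters (S.X 0), l ∘ₗ U.subtype = a ∧ S.dualMap ∘ₗ l = b := by
  obtain ⟨a', ha'⟩ := RightCharacters.exists_extension a
  obtain ⟨c, hc⟩ := S.exists_dualMap_comp_eq (hU S) (U.liftQ (b - S.dualMap ∘ₗ a') (by
    intro v hv
    have h1 := LinearMap.congr_fun hab ⟨v, hv⟩
    have h2 := LinearMap.congr_fun ha' ⟨v, hv⟩
    simp only [LinearMap.comp_apply, Submodule.subtype_apply] at h1 h2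
    rw [LinearMap.mem_ker, LinearMap.sub_apply, LinearMap.comp_apply, h2, h1, sub_self]))
  refine ⟨a' + c ∘ₗ U.mkQ, ?_, ?_⟩
  · rw [LinearMap.add_comp, ha', LinearMap.comp_assoc,
      (LinearMap.exact_subtype_mkQ U).linearMap_comp_eq_zero,
      LinearMap.comp_zero, add_zero]
  · rw [LinearMap.comp_add, ← LinearMap.comp_assoc, hc, Submodule.liftQ_mkQ]; abel

end FGProjSequence

/-! ### The small object argument. -/

open Limits MorphismProperty IsGrothendieckAbelian in
-- All cells are monomorphisms, and every source embeds in `G`. A regular cardinal exceeding the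
-- number of subobjects of `G` therefore makes all sources small.
theorem hasSmallObjectArgument_of_mono {C : Type*} [Category.{u} C]
    [Abelian C] [IsGrothendieckAbelian.{u} C] {G : C} (I : MorphismProperty C)
    [MorphismProperty.IsSmall.{u} I] (hI : ∀ {A B : C} (i : A ⟶ B), I i → Mono i)
    (hG : ∀ {A B : C} (i : A ⟶ B), I i → ∃ j : A ⟶ G, Mono j) :
    HasSmallObjectArgument.{u} I := by
  obtain ⟨κ, hκ', hκ⟩ := HasCardinalLT.exists_regular_cardinal.{u} (Subobject G)
  have : Fact κ.IsRegular := ⟨hκ'⟩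
  have : Nonempty κ.ord.ToType := by simpa using hκ'.ne_zero
  have := WellFoundedLT.toOrderBot κ.ord.ToType
  exact ⟨κ, inferInstance, inferInstance,
    { preservesColimit {A B X Y} i hi f hf := by
        let hf' : (monomorphisms C).TransfiniteCompositionOfShape κ.ord.ToType f :=
          { toTransfiniteCompositionOfShape := hf.toTransfiniteCompositionOfShape
            map_mem j hj := by
              have := (hf.attachCells j hj).pushouts_coproducts
              simp only [ofHoms_homFamily] at this
              refine (?_ : _ ≤ monomorphisms C) _ this
              simp only [pushouts_le_iff, coproducts_le_iff]
              exact fun _ _ i hi => hI i hi }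
        have (j j' : κ.ord.ToType) (φ : j ⟶ j') : Mono (hf'.F.map φ) := hf'.mem_map φ
        apply preservesColimit_coyoneda_obj_of_mono (Y := hf'.F) (κ := κ)
        obtain ⟨j, hj⟩ := hG i hi
        exact Subobject.hasCardinalLT_of_mono hκ j }⟩

/-- A free module mapping onto the submodule of values of terms at any element. -/
abbrev TermModule (R : Type u) [Ring R] : Type u := SolutionTerm R →₀ Rᵐᵒᵖ

/-- The inclusions of submodules of `TermModule R` with weak flat quotient. -/
def weakFlatInclusions (R : Type u) [Ring R] : MorphismProperty (ModuleCat.{u} Rᵐᵒᵖ) :=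
  MorphismProperty.ofHoms
    (fun K : {K : Submodule Rᵐᵒᵖ (TermModule R) // TorVanishes R (TermModule R ⧸ K) 0} =>
      ModuleCat.ofHom (X := K.1) (Y := TermModule R) K.1.subtype)

instance (R : Type u) [Ring R] : MorphismProperty.IsSmall.{u} (weakFlatInclusions R) := by
  dsimp [weakFlatInclusions]
  infer_instance

instance (R : Type u) [Ring R] : (weakFlatInclusions R).HasSmallObjectArgument.{u} :=
  hasSmallObjectArgument_of_mono
    (G := ModuleCat.of Rᵐᵒᵖ (TermModule R)) _
    (by
      rintro _ _ _ ⟨K⟩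
      exact (ModuleCat.mono_iff_injective _).2 K.1.injective_subtype)
    (by
      rintro _ _ _ ⟨K⟩
      exact ⟨ModuleCat.ofHom (X := K.1) (Y := TermModule R) K.1.subtype,
        (ModuleCat.mono_iff_injective _).2 K.1.injective_subtype⟩)

theorem weakFlatInclusions_subtype {R : Type u} [Ring R] (K : Submodule Rᵐᵒᵖ (TermModule R))
    (hK : TorVanishes R (TermModule R ⧸ K) 0) :
    weakFlatInclusions R (ModuleCat.ofHom (X := K) (Y := TermModule R) K.subtype) :=
  MorphismProperty.ofHoms.mk
    (f := fun K : {K : Submodule Rᵐᵒᵖ (TermModule R) // TorVanishes R (TermModule R ⧸ K) 0} =>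
      ModuleCat.ofHom (X := K.1) (Y := TermModule R) K.1.subtype) ⟨K, hK⟩

/-! ### Existence of weak flat precovers. -/

section Precover

variable {R : Type u} [Ring R]

theorem weakFlatInclusions_rlp_iff {X Y : ModuleCat.{u} Rᵐᵒᵖ} (p : X ⟶ Y) :
    (weakFlatInclusions R).rlp p ↔ ∀ K : Submodule Rᵐᵒᵖ (TermModule R),
      TorVanishes R (TermModule R ⧸ K) 0 → ∀ (a : K →ₗ[Rᵐᵒᵖ] X) (b : TermModule R →ₗ[Rᵐᵒᵖ] Y),
        p.hom ∘ₗ a = b ∘ₗ K.subtype → ∃ l : TermModule R →ₗ[Rᵐᵒᵖ] X,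
          l ∘ₗ K.subtype = a ∧ p.hom ∘ₗ l = b := by
  constructor
  · intro h K hK a b hab
    have hlp := h _ (weakFlatInclusions_subtype K hK)
    have sq : CommSq (ModuleCat.ofHom a)
        (ModuleCat.ofHom (X := K) (Y := TermModule R) K.subtype) p (ModuleCat.ofHom b) :=
      ⟨ModuleCat.hom_ext hab⟩
    exact ⟨sq.lift.hom, congrArg ModuleCat.Hom.hom sq.fac_left,
      congrArg ModuleCat.Hom.hom sq.fac_right⟩
  · rintro h _ _ _ ⟨K⟩
    refine ⟨fun {a b} sq => ?_⟩
    obtain ⟨l, hl, hl'⟩ := h K.1 K.2 a.hom b.hom (congrArg ModuleCat.Hom.hom sq.w)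
    exact ⟨⟨⟨ModuleCat.ofHom l, ModuleCat.hom_ext hl, ModuleCat.hom_ext hl'⟩⟩⟩

/-- Each `S.dualMap` has the right lifting property, so every homomorphism from `W` to
`S.dualCycles` lifts through it. -/
theorem torVanishes_of_llp_rlp {W : ModuleCat.{u} Rᵐᵒᵖ}
    (i : ModuleCat.of Rᵐᵒᵖ PUnit.{u + 1} ⟶ W) (hi : (weakFlatInclusions R).rlp.llp i) :
    TorVanishes R W 0 := by
  intro S
  refine S.tensorExactAt_of_dualMap fun c => ?_
  have hlp := hi (ModuleCat.ofHom S.dualMap) ((weakFlatInclusions_rlp_iff _).2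
    fun K hK a b hab => S.exists_lift_dualMap hK a b hab)
  have sq : CommSq (0 : ModuleCat.of Rᵐᵒᵖ PUnit.{u + 1} ⟶ _) i (ModuleCat.ofHom S.dualMap)
      (ModuleCat.ofHom c) :=
    ⟨(ModuleCat.isZero_of_subsingleton (ModuleCat.of Rᵐᵒᵖ PUnit.{u + 1})).eq_of_src _ _⟩
  exact ⟨sq.lift.hom, congrArg ModuleCat.Hom.hom sq.fac_right⟩

variable {W M V : Type u} [AddCommGroup W] [Module Rᵐᵒᵖ W] [AddCommGroup M] [Module Rᵐᵒᵖ M]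
  [AddCommGroup V] [Module Rᵐᵒᵖ V]

theorem LinearPMap.exists_domain_eq_range {F : Type u} [AddCommGroup F] [Module Rᵐᵒᵖ F]
    (π : F →ₗ[Rᵐᵒᵖ] V) (l : F →ₗ[Rᵐᵒᵖ] W) (h : LinearMap.ker π ≤ LinearMap.ker l) :
    ∃ r : V →ₗ.[Rᵐᵒᵖ] W, r.domain = LinearMap.range π ∧
      ∀ (x : r.domain) (y : F), π y = x → r x = l y := by
  refine ⟨⟨LinearMap.range π, (LinearMap.ker π).liftQ l h ∘ₗ
    π.quotKerEquivRange.symm.toLinearMap⟩, rfl, ?_⟩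
  rintro ⟨_, hx⟩ y rfl
  have : π.quotKerEquivRange.symm ⟨π y, hx⟩ = Submodule.Quotient.mk y := by
    rw [LinearEquiv.symm_apply_eq]; rfl
  change (LinearMap.ker π).liftQ l h (π.quotKerEquivRange.symm ⟨π y, hx⟩) = _
  rw [this]; rfl

/-- A lift defined on a proper pure submodule extends to a strictly larger one. -/
theorem exists_extension_lift {p : W →ₗ[Rᵐᵒᵖ] M}
    (hp : ∀ K : Submodule Rᵐᵒᵖ (TermModule R),
      TorVanishes R (TermModule R ⧸ K) 0 → ∀ (a : K →ₗ[Rᵐᵒᵖ] W) (b : TermModule R →ₗ[Rᵐᵒᵖ] M),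
        p ∘ₗ a = b ∘ₗ K.subtype → ∃ l : TermModule R →ₗ[Rᵐᵒᵖ] W,
          l ∘ₗ K.subtype = a ∧ p ∘ₗ l = b)
    (hV : TorVanishes R V 0) (f : V →ₗ[Rᵐᵒᵖ] M) (q : V →ₗ.[Rᵐᵒᵖ] W)
    (hq : IsPureSubmodule q.domain) (hqf : ∀ x : q.domain, p (q x) = f x) (x : V) :
    ∃ q' : V →ₗ.[Rᵐᵒᵖ] W, q ≤ q' ∧ IsPureSubmodule q'.domain ∧
      (∀ x : q'.domain, p (q' x) = f x) ∧ x ∈ q'.domain := by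
  let E := SolutionTerm.values R (q.domain.mkQ x)
  have hE : IsPureSubmodule E := SolutionTerm.isPureSubmodule_values _
  let π := Finsupp.linearCombination Rᵐᵒᵖ (SolutionTerm.eval (R := R) (q.domain.mkQ x))
  have hπ : LinearMap.range π = E := SolutionTerm.range_linearCombination_eval _
  obtain ⟨π', hπ'⟩ := Module.projective_lifting_property q.domain.mkQ π q.domain.mkQ_surjective
  have hπ'' : ∀ y, q.domain.mkQ (π' y) = π y := fun y => LinearMap.congr_fun hπ' y
  -- The quotient is isomorphic to `E`, a pure submodule of the pure quotient `V ⧸ q.domain`, hence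
  -- weak flat.
  have hK : TorVanishes R (TermModule R ⧸ LinearMap.ker π) 0 :=
    (hE.torVanishes (hq.torVanishes_quotient hV)).of_equiv
      ((LinearEquiv.ofEq _ _ hπ.symm).trans π.quotKerEquivRange.symm)
  have hker : ∀ y : LinearMap.ker π, π' y ∈ q.domain := fun y => by
    rw [← Submodule.Quotient.mk_eq_zero, ← Submodule.mkQ_apply, hπ'']
    exact y.2
  obtain ⟨l, hl, hpl⟩ := hp (LinearMap.ker π) hK
    (q.toFun ∘ₗ (π' ∘ₗ (LinearMap.ker π).subtype).codRestrict q.domain hker) (f ∘ₗ π')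
    (LinearMap.ext fun y => hqf _)
  have hl' : ∀ (y : TermModule R) (hy : π' y ∈ q.domain), l y = q ⟨π' y, hy⟩ := fun y hy => by
    have : y ∈ LinearMap.ker π := by
      rw [LinearMap.mem_ker, ← hπ'', Submodule.mkQ_apply, Submodule.Quotient.mk_eq_zero]
      exact hy
    exact LinearMap.congr_fun hl ⟨y, this⟩
  -- The lift `l` descends to the range of `π'`: wherever `π'` lands in `q.domain`, `l` is `q ∘ π'`,
  -- so it vanishes on `ker π'`. The same identity lets `r` be glued to `q`.
  obtain ⟨r, hr, hrl⟩ := LinearPMap.exists_domain_eq_range π' l (fun y hy => by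
    rw [LinearMap.mem_ker] at hy
    rw [LinearMap.mem_ker, hl' y (hy ▸ q.domain.zero_mem)]
    exact (congrArg q (Subtype.ext hy)).trans q.map_zero)
  have hcompat : ∀ (x : q.domain) (y : r.domain), (x : V) = y → q x = r y := by
    intro x y hxy
    obtain ⟨z, hz⟩ : (y : V) ∈ LinearMap.range π' := hr ▸ y.2
    rw [hrl y z hz, hl' z (by rw [hz, ← hxy]; exact x.2)]
    exact congrArg q (Subtype.ext (hxy.trans hz.symm))
  have hdom : (q.sup r hcompat).domain = E.comap q.domain.mkQ := by
    rw [LinearPMap.domain_sup, hr]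
    refine le_antisymm (sup_le ?_ ?_) ?_
    · intro v hv
      rw [Submodule.mem_comap, Submodule.mkQ_apply, (Submodule.Quotient.mk_eq_zero _).2 hv]
      exact E.zero_mem
    · rintro _ ⟨y, rfl⟩
      rw [Submodule.mem_comap, hπ'', ← hπ]
      exact ⟨y, rfl⟩
    · intro v hv
      rw [Submodule.mem_comap, ← hπ] at hv
      obtain ⟨y, hy⟩ := hv
      refine Submodule.mem_sup.2 ⟨v - π' y, ?_, π' y, ⟨y, rfl⟩, sub_add_cancel _ _⟩
      rw [← Submodule.Quotient.mk_eq_zero, ← Submodule.mkQ_apply, map_sub, hπ'', hy, sub_self]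
  refine ⟨q.sup r hcompat, q.left_le_sup r hcompat, hdom ▸ hq.comap_mkQ hE, ?_,
    hdom ▸ SolutionTerm.self_mem_values (q.domain.mkQ x)⟩
  rintro ⟨z, hz⟩
  obtain ⟨v, hv, w, hw, rfl⟩ := Submodule.mem_sup.1 hz
  refine (congrArg p (LinearPMap.sup_apply hcompat ⟨v, hv⟩ ⟨w, hw⟩ ⟨v + w, hz⟩ rfl)).trans ?_
  rw [map_add, hqf, map_add]
  obtain ⟨y, rfl⟩ : w ∈ LinearMap.range π' := hr ▸ hw
  rw [hrl ⟨_, hw⟩ y rfl]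
  exact congrArg _ (LinearMap.congr_fun hpl y)

theorem exists_lift_of_torVanishes {p : W →ₗ[Rᵐᵒᵖ] M}
    (hp : ∀ K : Submodule Rᵐᵒᵖ (TermModule R),
      TorVanishes R (TermModule R ⧸ K) 0 → ∀ (a : K →ₗ[Rᵐᵒᵖ] W) (b : TermModule R →ₗ[Rᵐᵒᵖ] M),
        p ∘ₗ a = b ∘ₗ K.subtype → ∃ l : TermModule R →ₗ[Rᵐᵒᵖ] W,
          l ∘ₗ K.subtype = a ∧ p ∘ₗ l = b)
    (hV : TorVanishes R V 0) (f : V →ₗ[Rᵐᵒᵖ] M) : ∃ g : V →ₗ[Rᵐᵒᵖ] W, p ∘ₗ g = f := by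
  obtain ⟨q, ⟨hq, hqf⟩, hmax⟩ := zorn_le₀
    {q : V →ₗ.[Rᵐᵒᵖ] W | IsPureSubmodule q.domain ∧ ∀ x : q.domain, p (q x) = f x} (by
      intro c hc hchain
      rcases c.eq_empty_or_nonempty with rfl | hne
      · refine ⟨⊥, ⟨isPureSubmodule_bot, ?_⟩, by simp⟩
        rintro ⟨x, hx⟩
        obtain rfl : x = 0 := (Submodule.mem_bot _).1 hx
        exact ((congrArg p (LinearPMap.map_zero _)).trans (map_zero p)).trans (map_zero f).symm
      · have hdir := hchain.directedOn
        refine ⟨LinearPMap.sSup c hdir, ⟨?_, ?_⟩, fun q hq => LinearPMap.le_sSup hdir hq⟩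
        · rw [LinearPMap.domain_sSup]
          refine isPureSubmodule_sSup (hne.image _) ?_ ?_
          · exact directedOn_image.2 (hdir.mono fun _ _ h => h.1)
          · rintro _ ⟨q, hq, rfl⟩
            exact (hc hq).1
        · rintro ⟨x, hx⟩
          obtain ⟨q, hq, hxq⟩ := (LinearPMap.mem_domain_sSup_iff hne hdir).1 hx
          exact (congrArg p (LinearPMap.sSup_apply hdir hq ⟨x, hxq⟩)).trans ((hc hq).2 ⟨x, hxq⟩))
  have htop : ∀ x, x ∈ q.domain := fun x => by
    obtain ⟨q', hqq', hq', hq'f, hx⟩ := exists_extension_lift hp hV f q hq hqf x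
    exact (hmax ⟨hq', hq'f⟩ hqq').1 hx
  exact ⟨q.toFun ∘ₗ LinearMap.id.codRestrict q.domain htop, LinearMap.ext fun x => hqf _⟩

end Precover

/-- A weak flat precover of a right module. -/
structure WeakFlatPrecover (R M : Type u) [Ring R] [AddCommGroup M] [Module Rᵐᵒᵖ M] where
  W : Type u
  [addCommGroup : AddCommGroup W]
  [module : Module Rᵐᵒᵖ W]
  p : W →ₗ[Rᵐᵒᵖ] M
  isWeakFlat : IsWeakFlat R W
  exists_lift : ∀ (V : Type u) [AddCommGroup V] [Module Rᵐᵒᵖ V], IsWeakFlat R V →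
    ∀ f : V →ₗ[Rᵐᵒᵖ] M, ∃ g : V →ₗ[Rᵐᵒᵖ] W, p ∘ₗ g = f

attribute [instance] WeakFlatPrecover.addCommGroup WeakFlatPrecover.module

theorem WeakFlatPrecover.nonempty (R M : Type u) [Ring R] [AddCommGroup M] [Module Rᵐᵒᵖ M] :
    Nonempty (WeakFlatPrecover R M) := by
  -- Factoring `0 → M` gives the precover: the left factor makes `D.Z` weak flat, the right factor
  -- provides the lifts.
  let D := MorphismProperty.factorizationData (weakFlatInclusions R).rlp.llp
    (weakFlatInclusions R).rlp (0 : ModuleCat.of Rᵐᵒᵖ PUnit.{u + 1} ⟶ ModuleCat.of Rᵐᵒᵖ M)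
  exact ⟨{
    W := D.Z
    p := D.p.hom
    isWeakFlat := (isWeakFlat_iff R D.Z).2 (torVanishes_of_llp_rlp D.i D.hi)
    exists_lift := fun V _ _ hV f =>
      exists_lift_of_torVanishes ((weakFlatInclusions_rlp_iff D.p).1 D.hp)
        ((isWeakFlat_iff R V).1 hV) f }⟩

/-! ### Left weak flat resolutions: construction, exactness and syzygies. -/

section

variable {R : Type u} [Ring R]

theorem torVanishes_self : TorVanishes R Rᵐᵒᵖ 0 := by
  let φ (P : Type u) [AddCommGroup P] [Module R P] : BalancedTensor R Rᵐᵒᵖ P →+ P :=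
    BalancedTensor.lift
      (AddMonoidHom.mk' (fun r => DistribSMul.toAddMonoidHom P r.unop)
        (fun r s => AddMonoidHom.ext fun p => add_smul r.unop s.unop p))
      (fun m r p => mul_smul m.unop r p)
  have hφ : ∀ (P : Type u) [AddCommGroup P] [Module R P] (t : BalancedTensor R Rᵐᵒᵖ P),
      BalancedTensor.tmul R 1 (φ P t) = t := fun P _ _ t => by
    have : (BalancedTensor.mk R Rᵐᵒᵖ P 1).comp (φ P) = AddMonoidHom.id _ :=
      BalancedTensor.hom_ext fun r p => by
        change BalancedTensor.tmul R 1 (r.unop • p) = BalancedTensor.tmul R r p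
        rw [← BalancedTensor.smul_tmul, MulOpposite.op_unop, smul_eq_mul, mul_one]
    exact DFunLike.congr_fun this t
  intro S
  rw [tensorExactAt_iff]
  intro t ht
  obtain ⟨y, hy⟩ := (S.exact 0 (φ _ t)).1 (by
    have := congrArg (φ _) ht
    rw [← hφ _ t, BalancedTensor.map_tmul, map_zero] at this
    exact (one_smul R _).symm.trans this)
  exact ⟨BalancedTensor.tmul R 1 y, by rw [BalancedTensor.map_tmul, hy]; exact hφ _ t⟩

theorem torVanishes_ker_iff {A B C : Type u} [AddCommGroup A] [Module Rᵐᵒᵖ A] [AddCommGroup B]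
    [Module Rᵐᵒᵖ B] [AddCommGroup C] [Module Rᵐᵒᵖ C] {f : A →ₗ[Rᵐᵒᵖ] B} {g : B →ₗ[Rᵐᵒᵖ] C}
    (hfg : Function.Exact f g) (hA : TorVanishes R A 0) (i : ℕ) :
    TorVanishes R (LinearMap.ker f) i ↔ TorVanishes R (LinearMap.ker g) (i + 1) := by
  let f' := f.codRestrict (LinearMap.ker g) hfg.apply_apply_eq_zero
  have hex : Function.Exact (LinearMap.ker f).subtype f' := fun a => by
    rw [show f' a = 0 ↔ f a = 0 from Subtype.ext_iff]
    exact f.exact_subtype_ker_map a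
  have hsurj : Function.Surjective f' := fun b => by
    obtain ⟨a, ha⟩ := (hfg b).1 b.2
    exact ⟨a, Subtype.ext ha⟩
  have hinj := (LinearMap.ker f).injective_subtype
  exact ⟨TorVanishes.of_shortExact_right hinj hex hsurj hA,
    TorVanishes.of_shortExact_left hinj hex hsurj hA⟩

end

namespace LeftWFResolution

variable {R M : Type u} [Ring R] [AddCommGroup M] [Module Rᵐᵒᵖ M]

/-- A chosen weak flat precover. -/
def precover (R M : Type u) [Ring R] [AddCommGroup M] [Module Rᵐᵒᵖ M] : WeakFlatPrecover R M :=
  (WeakFlatPrecover.nonempty R M).some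

/-- The iterated kernels of weak flat precovers. -/
def syzygy (R M : Type u) [Ring R] [AddCommGroup M] [Module Rᵐᵒᵖ M] : ℕ → ModuleCat.{u} Rᵐᵒᵖ
  | 0 => ModuleCat.of Rᵐᵒᵖ M
  | n + 1 => ModuleCat.of Rᵐᵒᵖ (LinearMap.ker (precover R (syzygy R M n)).p)

/-- The inclusion of an iterated kernel into the previous precover. -/
def syzygyIncl (R M : Type u) [Ring R] [AddCommGroup M] [Module Rᵐᵒᵖ M] (n : ℕ) :
    syzygy R M (n + 1) →ₗ[Rᵐᵒᵖ] (precover R (syzygy R M n)).W :=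
  (LinearMap.ker (precover R (syzygy R M n)).p).subtype

theorem exists_lift_syzygyIncl {V : Type u} [AddCommGroup V] [Module Rᵐᵒᵖ V]
    (hV : IsWeakFlat R V) (n : ℕ) (f : V →ₗ[Rᵐᵒᵖ] (precover R (syzygy R M n)).W)
    (hf : (precover R (syzygy R M n)).p ∘ₗ f = 0) :
    ∃ g : V →ₗ[Rᵐᵒᵖ] (precover R (syzygy R M (n + 1))).W,
      (syzygyIncl R M n ∘ₗ (precover R (syzygy R M (n + 1))).p) ∘ₗ g = f := by
  obtain ⟨g, hg⟩ := (precover R (syzygy R M (n + 1))).exists_lift V hV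
    (f.codRestrict (LinearMap.ker (precover R (syzygy R M n)).p) (LinearMap.congr_fun hf))
  exact ⟨g, by rw [LinearMap.comp_assoc, hg]; rfl⟩

theorem p_comp_syzygyIncl (n : ℕ) :
    (precover R (syzygy R M n)).p ∘ₗ syzygyIncl R M n = 0 :=
  LinearMap.ext fun x => x.2

/-- The left weak flat resolution obtained by iterating precovers. -/
def ofPrecovers (R M : Type u) [Ring R] [AddCommGroup M] [Module Rᵐᵒᵖ M] :
    LeftWFResolution R M where
  W n := (precover R (syzygy R M n)).W
  d n := syzygyIncl R M n ∘ₗ (precover R (syzygy R M (n + 1))).p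
  aug := (precover R (syzygy R M 0)).p
  d_comp_d n := by
    rw [LinearMap.comp_assoc, ← LinearMap.comp_assoc _ _ (precover R (syzygy R M (n + 1))).p,
      p_comp_syzygyIncl, LinearMap.zero_comp, LinearMap.comp_zero]
  aug_comp_d := LinearMap.ext fun w =>
    LinearMap.congr_fun (p_comp_syzygyIncl 0) ((precover R (syzygy R M (0 + 1))).p w)
  isWeakFlat n := (precover R (syzygy R M n)).isWeakFlat
  hom_exact_aug := (precover R (syzygy R M 0)).exists_lift
  hom_exact_zero V _ _ hV f hf := exists_lift_syzygyIncl hV 0 f hf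
  hom_exact_succ V _ _ hV n f hf := exists_lift_syzygyIncl hV (n + 1) f
    (LinearMap.ext fun v => Subtype.ext (LinearMap.congr_fun hf v))

variable (P : LeftWFResolution R M)

theorem torVanishes_W (i : ℕ) : TorVanishes R (P.W i) 0 :=
  (isWeakFlat_iff R _).1 (P.isWeakFlat i)

theorem isWeakFlat_self : IsWeakFlat R Rᵐᵒᵖ := (isWeakFlat_iff R _).2 torVanishes_self

/-- Testing Hom-exactness on the weak flat module `R` gives ordinary exactness. -/
theorem aug_surjective : Function.Surjective P.aug := fun m => by
  obtain ⟨g, hg⟩ := P.hom_exact_aug Rᵐᵒᵖ isWeakFlat_self (LinearMap.toSpanSingleton Rᵐᵒᵖ M m)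
  exact ⟨g 1, by simpa using LinearMap.congr_fun hg 1⟩

theorem exact_zero : Function.Exact (P.d 0) P.aug := fun w => by
  refine ⟨fun hw => ?_, fun ⟨v, hv⟩ => hv ▸ LinearMap.congr_fun P.aug_comp_d v⟩
  obtain ⟨g, hg⟩ := P.hom_exact_zero Rᵐᵒᵖ isWeakFlat_self (LinearMap.toSpanSingleton Rᵐᵒᵖ _ w)
    (by ext; simpa using hw)
  exact ⟨g 1, by simpa using LinearMap.congr_fun hg 1⟩

theorem exact_succ (i : ℕ) : Function.Exact (P.d (i + 1)) (P.d i) := fun w => by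
  refine ⟨fun hw => ?_, fun ⟨v, hv⟩ => hv ▸ LinearMap.congr_fun (P.d_comp_d i) v⟩
  obtain ⟨g, hg⟩ := P.hom_exact_succ Rᵐᵒᵖ isWeakFlat_self i
    (LinearMap.toSpanSingleton Rᵐᵒᵖ _ w) (by ext; simpa using hw)
  exact ⟨g 1, by simpa using LinearMap.congr_fun hg 1⟩

theorem torVanishes_ker_aug_iff (i : ℕ) :
    TorVanishes R (LinearMap.ker P.aug) i ↔ TorVanishes R M (i + 1) :=
  have hinj := (LinearMap.ker P.aug).injective_subtype
  have hex := P.aug.exact_subtype_ker_map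
  ⟨TorVanishes.of_shortExact_right hinj hex P.aug_surjective (P.torVanishes_W 0),
    TorVanishes.of_shortExact_left hinj hex P.aug_surjective (P.torVanishes_W 0)⟩

/-- The kernel of `d t` lies in `W (t + 1)` and is the syzygy of order `t + 2`; each step shifts Tor
by one. -/
theorem torVanishes_ker_d_iff (t i : ℕ) :
    TorVanishes R (LinearMap.ker (P.d t)) i ↔ TorVanishes R M (i + t + 2) := by
  induction t generalizing i with
  | zero =>
    rw [torVanishes_ker_iff P.exact_zero (P.torVanishes_W 1), P.torVanishes_ker_aug_iff]
  | succ t ih =>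
    rw [torVanishes_ker_iff (P.exact_succ t) (P.torVanishes_W (t + 2)), ih,
      show i + 1 + t + 2 = i + (t + 1) + 2 by omega]

section

variable (L : Type u) [AddCommGroup L] [Module Rᵐᵒᵖ L]

theorem subsingleton_extWF_succ_iff (t : ℕ) :
    Subsingleton (P.ExtWF L (t + 1)) ↔
      ∀ f : L →ₗ[Rᵐᵒᵖ] P.W (t + 1), P.d t ∘ₗ f = 0 →
        ∃ g : L →ₗ[Rᵐᵒᵖ] P.W (t + 2), P.d (t + 1) ∘ₗ g = f := by
  have : (P.boundaries L (t + 1)).addSubgroupOf (P.cycles L (t + 1)) = ⊤ ↔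
      Subsingleton (P.ExtWF L (t + 1)) :=
    ⟨fun h => by rw [ExtWF, h]; exact QuotientAddGroup.subsingleton_quotient_top,
      fun h => QuotientAddGroup.addSubgroup_eq_top_of_subsingleton _ h⟩
  rw [← this, AddSubgroup.addSubgroupOf_eq_top]
  exact Iff.rfl

/-- Since `ker (d t)` is weak flat, its inclusion factors through `d (t + 1)` by some `σ`, and `σ`
lifts all cycles at once. -/
theorem subsingleton_extWF_of_torVanishes {t n : ℕ} (h : TorVanishes R M n) (ht : n ≤ t + 2) :
    Subsingleton (P.ExtWF L (t + 1)) := by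
  rw [subsingleton_extWF_succ_iff]
  intro f hf
  have hK : IsWeakFlat R (LinearMap.ker (P.d t)) :=
    (isWeakFlat_iff R _).2 ((P.torVanishes_ker_d_iff t 0).2 (h.mono (by omega)))
  obtain ⟨σ, hσ⟩ := P.hom_exact_succ _ hK t (LinearMap.ker (P.d t)).subtype
    (LinearMap.ext fun x => x.2)
  refine ⟨σ ∘ₗ f.codRestrict (LinearMap.ker (P.d t)) (LinearMap.congr_fun hf), ?_⟩
  rw [← LinearMap.comp_assoc, hσ]; rfl

end

/-- Vanishing says that maps from finitely presented modules to `ker (d t)` lift to `W (t + 2)`, so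
`ker (d t)` is a pure quotient of a weak flat module. -/
theorem torVanishes_of_subsingleton_extWF {t : ℕ}
    (h : ∀ (L : Type u) [AddCommGroup L] [Module Rᵐᵒᵖ L], Module.FinitePresentation Rᵐᵒᵖ L →
      Subsingleton (P.ExtWF L (t + 1))) : TorVanishes R M (t + 2) := by
  have hlift : LiftsSolutions ((P.d (t + 1)).codRestrict (LinearMap.ker (P.d t))
      (LinearMap.congr_fun (P.d_comp_d t))) :=
    LiftsSolutions.of_lifts_finitePresentation fun L _ _ hL f => by
      obtain ⟨g, hg⟩ := (P.subsingleton_extWF_succ_iff L t).1 (h L hL)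
        ((LinearMap.ker (P.d t)).subtype ∘ₗ f) (LinearMap.ext fun l => (f l).2)
      exact ⟨g, LinearMap.ext fun l => Subtype.ext (LinearMap.congr_fun hg l)⟩
  have := (P.torVanishes_ker_d_iff t 0).1 (hlift.torVanishes (P.torVanishes_W (t + 2)))
  rwa [Nat.zero_add] at this

end LeftWFResolution

end

theorem mainTheorem6 (R : Type u) [Ring R] (n : ℕ) (hn : 2 ≤ n)
    (M : Type u) [AddCommGroup M] [Module Rᵐᵒᵖ M] :
    Nonempty (LeftWFResolution R M) ∧
    ∀ P : LeftWFResolution R M, List.TFAE [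
      weakFlatDim R M ≤ n,
      ∀ (L : Type u) [AddCommGroup L] [Module Rᵐᵒᵖ L],
        ∀ m : ℕ, n - 1 ≤ m → Subsingleton (P.ExtWF L m),
      ∀ (L : Type u) [AddCommGroup L] [Module Rᵐᵒᵖ L],
        Subsingleton (P.ExtWF L (n - 1)),
      ∀ (L : Type u) [AddCommGroup L] [Module Rᵐᵒᵖ L], IsPureProjective R L →
        ∀ m : ℕ, n - 1 ≤ m → Subsingleton (P.ExtWF L m),
      ∀ (L : Type u) [AddCommGroup L] [Module Rᵐᵒᵖ L], IsPureProjective R L →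
        Subsingleton (P.ExtWF L (n - 1)),
      ∀ (L : Type u) [AddCommGroup L] [Module Rᵐᵒᵖ L], Module.FinitePresentation Rᵐᵒᵖ L →
        ∀ m : ℕ, n - 1 ≤ m → Subsingleton (P.ExtWF L m),
      ∀ (L : Type u) [AddCommGroup L] [Module Rᵐᵒᵖ L], Module.FinitePresentation Rᵐᵒᵖ L →
        Subsingleton (P.ExtWF L (n - 1))] := by
  refine ⟨⟨LeftWFResolution.ofPrecovers R M⟩, fun P => ?_⟩
  -- Here `2 ≤ n` matters: degree `n - 1 = t + 1` is positive, so its cycles come from `ker (d t)`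
  -- and the augmentation plays no role.
  obtain ⟨t, rfl⟩ : ∃ t, n = t + 2 := ⟨n - 2, by omega⟩
  rw [show t + 2 - 1 = t + 1 by omega]
  tfae_have 1 → 2 := by
    intro h L _ _ m hm
    obtain ⟨s, rfl⟩ : ∃ s, m = s + 1 := ⟨m - 1, by omega⟩
    exact P.subsingleton_extWF_of_torVanishes L ((weakFlatDim_le_iff R M _).1 h) (by omega)
  tfae_have 2 → 4 := fun h L _ _ _ => h L
  tfae_have 4 → 6 := fun h L _ _ _ => h L (isPureProjective_of_finitePresentation L)
  tfae_have 6 → 7 := fun h L _ _ hL => h L hL _ le_rfl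
  tfae_have 2 → 3 := fun h L _ _ => h L _ le_rfl
  tfae_have 3 → 5 := fun h L _ _ _ => h L
  tfae_have 5 → 7 := fun h L _ _ _ => h L (isPureProjective_of_finitePresentation L)
  tfae_have 7 → 1 := fun h =>
    (weakFlatDim_le_iff R M _).2 (P.torVanishes_of_subsingleton_extWF h)
  tfae_finish
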